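/- Let $q$ be a prime power, $E$ an $n$-dimensional vector space over $\mathbb{F}_q$, and let $\perp$ be a fixed involutive anti-isomorphism of the lattice of subspaces of $E$. A $q$-matroid $M=(E,\rho)$ is a function $\rho$ from the subspaces of $E$ to $\mathbb{N}_0$ with $\rho(A)\le\dim A$, $\rho(A)\le\rho(B)$ for $A\le B$, and $\rho(A+B)+\rho(A\cap B)\le\rho(A)+\rho(B)$. Its dual $M^*$ has rank function $\rho^*(A)=\dim A-\rho(E)+\rho(A^\perp)$, and for $T\le E$ the contraction $M/T$ is the $q$-matroid on $E/T$ with $\rho_{M/T}(A/T)=\rho(A)-\rho(T)$. A subspace $A$ is independent if $\rho(A)=\dim A$; a circuit of $M$ is a minimal subspace that is not independent, and a cocircuit of $M$ is a circuit of $M^*$. A flat is a subspace that equals the sum of all subspaces that contain it and have the same rank, and a hyperplane is a maximal flat different from $E$. Let $d_M$ be the least dimension of a cocircuit of $M$ (so $d_{M^*}$ is the least dimension of a circuit of $M$). Put $$p(M;z)=\sum_{X\le E}\mu(0,X)\,z^{\rho(E)-\rho(X)}\in\mathbb{Z}[z],\qquad A_M(i;z)=\sum_{X\le E,\ \dim X=i}p(M/X^\perp;z),$$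 where $\mu$ is the Möbius function of the lattice of subspaces of $E$; $A_M(i;z)$ does not depend on the choice of $\perp$, and $A_{M/T}(i;z)$ is defined in the same way on $E/T$. A set $\mathcal{B}$ of subspaces of $E$, all of the same dimension, forms the blocks of a $t$-subspace design if the number of members of $\mathcal{B}$ that contain $T$ is the same for all $t$-dimensional $T\le E$ (this number may be $0$). Let $M$ be a $q$-matroid on $E$ that has at least one circuit and at least one cocircuit. Let $\mathbb{F}$ be a field of characteristic $0$, let $\theta\in\mathbb{F}$ with $\theta\ne1$, and let $t$ be an integer with $0<t<d_M$. Suppose that 1. $\left|\{j\in\{1,\dots,n-t\}:A_{M^*}(j;\theta)\ne0\}\right|\le d_M-t$, and 2. for every $t$-dimensional $T\le E$ and every $j\le n-t$, if $A_{M^*}(j;\theta)=0$, then $A_{M^*/T}(j;\theta)=0$. (a) Let $p\le n$ be the greatest integer such that every subspace of $E$ of dimension at most $p$ contains at most one cocircuit of $M$. Then for each $i\in\{d_M,\dots,p\}$ the set of cocircuits of $M$ of dimension $\min\{i,n-t\}$ forms the blocks of a $t$-subspace design, and so does the set of hyperplanes of $M$ of dimension $n-i$. (b) Let $p\le n$ be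 the greatest integer such that every subspace of $E$ of dimension at most $p$ contains at most one circuit of $M$. Then for each $i\in\{d_{M^*},\dots,p\}$ the set of circuits of $M$ of dimension $\min\{i,n-t\}$ forms the blocks of a $t$-subspace design, and so does the set of hyperplanes of $M^*$ of dimension $n-i$. -/

import Mathlib

open Module

universe u v w

/-- An involutive anti-isomorphism `U ↦ U^⊥` of the lattice of subspaces of `E`. An order-reversing
involution is automatically bijective and interchanges sums and intersections. -/
structure SubspaceDuality (K : Type u) (E : Type v) [Field K] [AddCommGroup E] [Module K E] where
  /-- The dual `U^⊥` of a subspace `U`. -/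
  perp : Submodule K E → Submodule K E
  perp_perp : ∀ U, perp (perp U) = U
  perp_anti : ∀ U V, U ≤ V → perp V ≤ perp U

namespace SubspaceDuality

variable {K : Type u} {E : Type v} [Field K] [AddCommGroup E] [Module K E]

theorem perp_le_iff (δ : SubspaceDuality K E) (U V : Submodule K E) :
    δ.perp U ≤ V ↔ δ.perp V ≤ U :=
  ⟨fun h => by simpa [δ.perp_perp] using δ.perp_anti _ _ h,
   fun h => by simpa [δ.perp_perp] using δ.perp_anti _ _ h⟩

theorem le_perp_iff (δ : SubspaceDuality K E) (U V : Submodule K E) :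
    U ≤ δ.perp V ↔ V ≤ δ.perp U :=
  ⟨fun h => by simpa [δ.perp_perp] using δ.perp_anti _ _ h,
   fun h => by simpa [δ.perp_perp] using δ.perp_anti _ _ h⟩

theorem perp_sup (δ : SubspaceDuality K E) (U V : Submodule K E) :
    δ.perp (U ⊔ V) = δ.perp U ⊓ δ.perp V := by
  apply le_antisymm
  · exact le_inf (δ.perp_anti _ _ le_sup_left) (δ.perp_anti _ _ le_sup_right)
  · rw [δ.le_perp_iff]
    exact sup_le ((δ.le_perp_iff _ _).1 inf_le_left) ((δ.le_perp_iff _ _).1 inf_le_right)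

theorem perp_inf (δ : SubspaceDuality K E) (U V : Submodule K E) :
    δ.perp (U ⊓ V) = δ.perp U ⊔ δ.perp V := by
  have h := δ.perp_sup (δ.perp U) (δ.perp V)
  rw [δ.perp_perp, δ.perp_perp] at h
  rw [← h, δ.perp_perp]

theorem perp_bot (δ : SubspaceDuality K E) : δ.perp ⊥ = ⊤ :=
  top_le_iff.1 ((δ.le_perp_iff _ _).2 bot_le)

theorem perp_lt (δ : SubspaceDuality K E) {U V : Submodule K E} (h : U < V) :
    δ.perp V < δ.perp U := by
  refine lt_of_le_of_ne (δ.perp_anti _ _ h.le) fun he => h.ne ?_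
  rw [← δ.perp_perp U, ← he, δ.perp_perp]

theorem le_finrank_perp [FiniteDimensional K E] (δ : SubspaceDuality K E) :
    ∀ (m : ℕ) (U : Submodule K E), finrank K E = finrank K U + m → m ≤ finrank K (δ.perp U) := by
  intro m
  induction m with
  | zero => intro U _; exact Nat.zero_le _
  | succ m ih =>
    intro U hU
    have hne : U ≠ ⊤ := by
      rintro rfl
      rw [finrank_top] at hU
      omega
    obtain ⟨x, -, hx⟩ := SetLike.exists_of_lt (lt_top_iff_ne_top.2 hne)
    have hlt : U < U ⊔ K ∙ x := by
      refine lt_of_le_of_ne le_sup_left fun he => hx ?_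
      rw [he]
      exact Submodule.mem_sup_right (Submodule.mem_span_singleton_self x)
    have h1 := Submodule.finrank_lt_finrank_of_lt hlt
    have h2 := Submodule.finrank_add_le_finrank_add_finrank U (K ∙ x)
    have h3 : finrank K (K ∙ x) ≤ 1 := (finrank_span_le_card ({x} : Set E)).trans (by simp)
    have h4 := ih (U ⊔ K ∙ x) (by omega)
    have h5 := Submodule.finrank_lt_finrank_of_lt (δ.perp_lt hlt)
    omega

theorem finrank_perp_le [FiniteDimensional K E] (δ : SubspaceDuality K E) :
    ∀ (m : ℕ) (U : Submodule K E), finrank K U = m →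
      finrank K (δ.perp U) + m ≤ finrank K E := by
  intro m
  induction m with
  | zero => intro U _; exact Submodule.finrank_le _
  | succ m ih =>
    intro U hU
    obtain ⟨W, hW, hWm⟩ : ∃ W : Submodule K E, W < U ∧ finrank K W = m := by
      have hf := exists_linearIndependent_of_le_finrank (R := K) (M := U) (n := m) (by omega)
      obtain ⟨f, hf⟩ := hf
      have hr : finrank K (Submodule.span K (Set.range fun i => (f i : E))) = m := by
        have := finrank_span_eq_card (R := K) (b := fun i => (f i : E))
          (hf.map' U.subtype (Submodule.ker_subtype U))
        simpa using this
      refine ⟨_, lt_of_le_of_ne ?_ ?_, hr⟩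
      · rw [Submodule.span_le]
        rintro _ ⟨i, rfl⟩
        exact (f i).2
      · intro he
        rw [he] at hr
        omega
    have h1 := ih W hWm
    have h2 := Submodule.finrank_lt_finrank_of_lt (δ.perp_lt hW)
    omega

theorem finrank_perp [FiniteDimensional K E] (δ : SubspaceDuality K E) (U : Submodule K E) :
    finrank K (δ.perp U) + finrank K U = finrank K E := by
  have h0 := Submodule.finrank_le U
  have h1 := δ.le_finrank_perp (finrank K E - finrank K U) U (by omega)
  have h2 := δ.finrank_perp_le _ U rfl
  omega

end SubspaceDuality

/-- A `(q,r)`-polymatroid on the `K`-vector space `E` (with `K` the field of order `q`). -/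
structure QPolymatroid (K : Type u) (E : Type v) [Field K] [AddCommGroup E] [Module K E]
    (r : ℕ) where
  /-- The rank function. -/
  rk : Submodule K E → ℕ
  rk_le : ∀ A, rk A ≤ r * finrank K A
  rk_mono : ∀ A B, A ≤ B → rk A ≤ rk B
  rk_submod : ∀ A B, rk (A ⊔ B) + rk (A ⊓ B) ≤ rk A + rk B

/-- A `q`-matroid is a `(q,1)`-polymatroid. -/
abbrev QMatroid (K : Type u) (E : Type v) [Field K] [AddCommGroup E] [Module K E] :=
  QPolymatroid K E 1

namespace QPolymatroid

variable {K : Type u} {E : Type v} [Field K] [AddCommGroup E] [Module K E] {r : ℕ}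

theorem rk_add_le [FiniteDimensional K E] (M : QPolymatroid K E r) {T A : Submodule K E}
    (h : T ≤ A) : M.rk A + r * finrank K T ≤ M.rk T + r * finrank K A := by
  obtain ⟨W, hW⟩ := exists_isCompl T
  have hsup : T ⊔ (W ⊓ A) = A := by
    rw [← sup_inf_assoc_of_le W h, hW.sup_eq_top, top_inf_eq]
  have hinf : T ⊓ (W ⊓ A) = ⊥ := by rw [← inf_assoc, hW.inf_eq_bot, bot_inf_eq]
  have h1 := M.rk_submod T (W ⊓ A)
  have h2 := M.rk_le (W ⊓ A)
  have h3 := Submodule.finrank_sup_add_finrank_inf_eq T (W ⊓ A)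
  rw [hsup] at h1 h3
  rw [hinf, finrank_bot] at h3
  have h4 : r * finrank K A = r * finrank K T + r * finrank K (W ⊓ A : Submodule K E) := by
    rw [← mul_add, ← h3, add_zero]
  omega

theorem rk_top_le_dual [FiniteDimensional K E] (δ : SubspaceDuality K E) (M : QPolymatroid K E r)
    (A : Submodule K E) : M.rk ⊤ ≤ r * finrank K A + M.rk (δ.perp A) := by
  have h := M.rk_add_le (le_top : δ.perp A ≤ ⊤)
  rw [finrank_top, ← δ.finrank_perp A, mul_add] at h
  omega

/-- The dual `M^*`, with `ρ^*(A) = r dim A - ρ(E) + ρ(A^⊥)`. The natural number subtraction never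
truncates, by `rk_top_le_dual`. -/
noncomputable def dual [FiniteDimensional K E] (δ : SubspaceDuality K E) (M : QPolymatroid K E r) :
    QPolymatroid K E r where
  rk A := r * finrank K A + M.rk (δ.perp A) - M.rk ⊤
  rk_le A := by
    have := M.rk_mono (δ.perp A) ⊤ le_top
    omega
  rk_mono A B h := by
    have h1 := M.rk_add_le (δ.perp_anti _ _ h)
    have hA := congrArg (r * ·) (δ.finrank_perp A)
    have hB := congrArg (r * ·) (δ.finrank_perp B)
    simp only [mul_add] at hA hB
    omega
  rk_submod A B := by
    have h1 := M.rk_submod (δ.perp A) (δ.perp B)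
    have h2 := congrArg (r * ·) (Submodule.finrank_sup_add_finrank_inf_eq A B)
    simp only [mul_add] at h2
    have hA := M.rk_top_le_dual δ A
    have hB := M.rk_top_le_dual δ B
    have hS := M.rk_top_le_dual δ (A ⊔ B)
    have hI := M.rk_top_le_dual δ (A ⊓ B)
    rw [δ.perp_sup] at hS ⊢
    rw [δ.perp_inf] at hI ⊢
    omega

theorem finrank_comap_mkQ [FiniteDimensional K E] (T : Submodule K E) (B : Submodule K (E ⧸ T)) :
    finrank K (B.comap T.mkQ) = finrank K B + finrank K T := by
  have h := LinearMap.finrank_range_add_finrank_ker (T.mkQ.domRestrict (B.comap T.mkQ))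
  have h1 : LinearMap.range (T.mkQ.domRestrict (B.comap T.mkQ)) = B := by
    rw [LinearMap.range_domRestrict, Submodule.map_comap_eq_of_surjective T.mkQ_surjective]
  have hle : T ≤ B.comap T.mkQ := by
    intro x hx
    rw [Submodule.mem_comap, Submodule.mkQ_apply, (Submodule.Quotient.mk_eq_zero T).2 hx]
    exact B.zero_mem
  have h2 : LinearMap.ker (T.mkQ.domRestrict (B.comap T.mkQ)) =
      T.comap (B.comap T.mkQ).subtype := by
    rw [LinearMap.ker_domRestrict, Submodule.ker_mkQ]
  rw [h1, h2, (Submodule.comapSubtypeEquivOfLe hle).finrank_eq] at h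
  exact h.symm

theorem le_comap_mkQ (T : Submodule K E) (B : Submodule K (E ⧸ T)) : T ≤ B.comap T.mkQ := by
  intro x hx
  rw [Submodule.mem_comap, Submodule.mkQ_apply, (Submodule.Quotient.mk_eq_zero T).2 hx]
  exact B.zero_mem

theorem comap_mkQ_sup (T : Submodule K E) (A B : Submodule K (E ⧸ T)) :
    (A ⊔ B).comap T.mkQ = A.comap T.mkQ ⊔ B.comap T.mkQ := by
  have h : T ≤ A.comap T.mkQ ⊔ B.comap T.mkQ := (le_comap_mkQ T A).trans le_sup_left
  have h2 := Submodule.comap_map_mkQ T (A.comap T.mkQ ⊔ B.comap T.mkQ)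
  rw [Submodule.map_sup, Submodule.map_comap_eq_of_surjective T.mkQ_surjective,
    Submodule.map_comap_eq_of_surjective T.mkQ_surjective, sup_eq_right.2 h] at h2
  exact h2

/-- The contraction `M/T` on `E/T`, with `ρ_{M/T}(A/T) = ρ(A) - ρ(T)` for `T ≤ A`. A subspace `B`
of `E/T` is `A/T` for `A` its preimage in `E`. -/
noncomputable def contract [FiniteDimensional K E] (M : QPolymatroid K E r) (T : Submodule K E) :
    QPolymatroid K (E ⧸ T) r where
  rk B := M.rk (B.comap T.mkQ) - M.rk T
  rk_le B := by
    have h := M.rk_add_le (le_comap_mkQ T B)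
    rw [finrank_comap_mkQ, mul_add] at h
    omega
  rk_mono A B h := Nat.sub_le_sub_right (M.rk_mono _ _ (Submodule.comap_mono h)) _
  rk_submod A B := by
    have h := M.rk_submod (A.comap T.mkQ) (B.comap T.mkQ)
    rw [comap_mkQ_sup, Submodule.comap_inf]
    have hA := M.rk_mono _ _ (le_comap_mkQ T A)
    have hB := M.rk_mono _ _ (le_comap_mkQ T B)
    have hI := M.rk_mono _ _ (le_comap_mkQ T (A ⊓ B))
    have hS := M.rk_mono _ _ ((le_comap_mkQ T A).trans (le_sup_left (b := B.comap T.mkQ)))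
    rw [Submodule.comap_inf] at hI
    omega

/-- The contraction `M.X = M/X^⊥` of `M` to `X`. -/
noncomputable def contractTo [FiniteDimensional K E] (δ : SubspaceDuality K E) (M : QPolymatroid K E r)
    (X : Submodule K E) : QPolymatroid K (E ⧸ δ.perp X) r :=
  M.contract (δ.perp X)

/-- `I` is independent if `ρ(I) = r dim I`. -/
def Indep (M : QPolymatroid K E r) (I : Submodule K E) : Prop :=
  M.rk I = r * finrank K I

/-- A circuit is a minimal dependent space. -/
def IsCircuit (M : QPolymatroid K E r) (C : Submodule K E) : Prop :=
  Minimal (fun X => ¬ M.Indep X) C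

/-- A cocircuit of `M` is a circuit of `M^*`. -/
def IsCocircuit [FiniteDimensional K E] (δ : SubspaceDuality K E) (M : QPolymatroid K E r)
    (C : Submodule K E) : Prop :=
  (M.dual δ).IsCircuit C

/-- The closure of `A`: the sum of all subspaces that contain `A` and have the same rank. -/
def closure (M : QPolymatroid K E r) (A : Submodule K E) : Submodule K E :=
  sSup {X | A ≤ X ∧ M.rk A = M.rk X}

/-- A flat is a closed subspace. -/
def IsFlat (M : QPolymatroid K E r) (F : Submodule K E) : Prop :=
  M.closure F = F

/-- A hyperplane is a maximal proper flat. -/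
def IsHyperplane (M : QPolymatroid K E r) (H : Submodule K E) : Prop :=
  H < ⊤ ∧ M.IsFlat H ∧ ∀ F, M.IsFlat F → H ≤ F → F = ⊤ ∨ F = H

/-- `ℓ_M(A) = ρ(E) - ρ(A)`. -/
def ell (M : QPolymatroid K E r) (A : Submodule K E) : ℕ :=
  M.rk ⊤ - M.rk A

variable (K E) in
open Classical in
/-- The Möbius function `μ(U, V)` of the lattice of subspaces of `E`, for `K` finite. -/
noncomputable def moebius [Finite K] [FiniteDimensional K E] (U V : Submodule K E) : ℤ :=
  haveI : Finite E := Module.finite_of_finite K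
  letI : Fintype (Submodule K E) := Fintype.ofFinite _
  letI : LocallyFiniteOrder (Submodule K E) := Fintype.toLocallyFiniteOrder
  IncidenceAlgebra.mu ℤ U V

/-- The characteristic polynomial `p(M; z) = ∑_{X ≤ E} μ(0, X) z^{ℓ(X)}`. -/
noncomputable def charPoly [Finite K] [FiniteDimensional K E] (M : QPolymatroid K E r) :
    Polynomial ℤ :=
  ∑ᶠ X : Submodule K E, Polynomial.C (moebius K E ⊥ X) * Polynomial.X ^ M.ell X

/-- The weight enumerator `A_M(i; z)`, the sum of `p(M/Y; z)` over the subspaces `Y` of codimension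
`i`, i.e. the sum of `p(M.X; z)` over the subspaces `X` of dimension `i`, whatever duality is used
to form `M.X = M/X^⊥`; see `weightEnum_eq`. -/
noncomputable def weightEnum [Finite K] [FiniteDimensional K E] (M : QPolymatroid K E r) (i : ℕ) :
    Polynomial ℤ :=
  ∑ᶠ (Y : Submodule K E) (_ : finrank K Y + i = finrank K E), (M.contract Y).charPoly

theorem weightEnum_eq [Finite K] [FiniteDimensional K E] (δ : SubspaceDuality K E)
    (M : QPolymatroid K E r) (i : ℕ) :
    M.weightEnum i =
      ∑ᶠ (X : Submodule K E) (_ : finrank K X = i), (M.contractTo δ X).charPoly := by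
  let e : Submodule K E ≃ Submodule K E :=
    ⟨δ.perp, δ.perp, δ.perp_perp, δ.perp_perp⟩
  unfold weightEnum
  rw [← finsum_comp_equiv e]
  refine finsum_congr fun X => ?_
  have h : (finrank K (e X) + i = finrank K E) ↔ finrank K X = i := by
    have := δ.finrank_perp X
    change finrank K (δ.perp X) + i = finrank K E ↔ _
    omega
  exact finsum_congr_Prop (propext h) fun _ => rfl

/-- `R_M(t; θ)`, the set of `j ∈ {1, …, n - t}` such that `A_{M^*}(j; θ) ≠ 0`. -/
def R [Finite K] [FiniteDimensional K E] (δ : SubspaceDuality K E) (M : QPolymatroid K E r)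
    {F : Type w} [Field F] (t : ℕ) (θ : F) : Set ℕ :=
  {j | 1 ≤ j ∧ j ≤ finrank K E - t ∧ Polynomial.aeval θ ((M.dual δ).weightEnum j) ≠ 0}

/-- `d_M`, the least dimension of a cocircuit of `M` (meaningful if `M` has a cocircuit). -/
noncomputable def d [FiniteDimensional K E] (δ : SubspaceDuality K E) (M : QPolymatroid K E r) :
    ℕ :=
  sInf {m | ∃ C, M.IsCocircuit δ C ∧ finrank K C = m}

end QPolymatroid

/-- `B` is the set of blocks of a `t`-subspace design with blocks of dimension `k`: all members of
`B` have dimension `k`, and all `t`-dimensional subspaces of `E` lie in the same number of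
members of `B`. -/
def IsSubspaceDesign {K : Type u} {E : Type v} [Field K] [AddCommGroup E] [Module K E]
    (t k : ℕ) (B : Set (Submodule K E)) : Prop :=
  (∀ X ∈ B, finrank K X = k) ∧
    ∃ l : ℕ, ∀ T : Submodule K E, finrank K T = t → {X | X ∈ B ∧ T ≤ X}.ncard = l

/-- `p` is the greatest integer `≤ dim E` such that every subspace of dimension at most `p` contains
at most one subspace with the property `P`. -/
def IsUniquenessBound {K : Type u} {E : Type v} [Field K] [AddCommGroup E] [Module K E]
    (P : Submodule K E → Prop) (p : ℕ) : Prop :=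
  IsGreatest {m : ℕ | m ≤ finrank K E ∧ ∀ X : Submodule K E, finrank K X ≤ m →
    ∀ C C' : Submodule K E, P C → P C' → C ≤ X → C' ≤ X → C = C'} p

/-! ### Möbius inversion and values of contracted characteristic polynomials -/

section
open scoped Classical
open QPolymatroid

/-! Write `N = M^*`, `n = dim E`, `q = |K|` and `a(Y) = p(N/Y; θ)`. By Möbius inversion the sum of
`a` over all `Y ≥ U` is `θ^ℓ(U)`, with `ℓ` taken in `N`, and `A_{N/T}(j; θ)` is the sum of `a` over
the `Y ≥ T` of codimension `j`.

Summing `θ^ℓ(U)` over `U = T + ⟨x_1, …, x_m⟩` for all `m`-tuples gives the moment `∑_j A_{N/T}(j; θ)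
q^((n-j)m)` (`sum_tuple_pow_ell`). If `dim T = t` and `m < d_M - t`, every such `U` has dimension
below `d_M`, hence is independent in `N`, and the moment does not depend on `T`. The two hypotheses
leave at most `d_M - t` unknown coefficients, so a Vandermonde argument shows that `A_{N/T}(j; θ)`
depends only on `j` (`weightAbove_eq_of_card_le`).

For (b): if `Y ≠ E` and `Y^⊥` contains at most one circuit of `M`, then `a(Y)` is `θ - 1` or `0`
according to whether `Y^⊥` is a circuit (`contractEval_dual_eq`). So `A_{N/T}(k; θ)` is `θ - 1`
times the number of hyperplanes of `N` of codimension `k` above `T`. Circuits follow by passing to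
the dual design.

For (a): the sum of `θ^nullity` over the `U ≥ T` of a given dimension is also independent of `T`
(`sum_above_pow_nullity_eq`). A space with at most one circuit of `N` has nullity 0 or 1, so
`θ^nullity` is affine in the number of circuits inside it. By strong induction on dimension the
smaller circuits form designs and contribute an amount independent of `T`
(`sum_above_sum_below_eq`); what remains counts the circuits of the given dimension through `T`.
Hyperplanes of `M` again come from the dual design. -/

noncomputable instance Submodule.fintypeOfFinite {K : Type u} {E : Type v} [Field K] [Finite K]
    [AddCommGroup E] [Module K E] [FiniteDimensional K E] : Fintype (Submodule K E) :=
  have : Finite E := Module.finite_of_finite K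
  Fintype.ofFinite _

/-- Uniqueness in Möbius inversion, by induction from the top: functions are identified through
their up-sums without computing any Möbius value. -/
theorem eq_of_forall_sum_ge_eq {α A : Type*} [Fintype α] [PartialOrder α] [AddCommGroup A]
    {f g : α → A} (U : α)
    (h : ∀ V, U ≤ V → ∑ Y with V ≤ Y, f Y = ∑ Y with V ≤ Y, g Y) : f U = g U := by
  induction U using (wellFounded_gt (α := α)).induction with
  | _ U ih =>
    have hs : (Finset.univ.filter fun Y => U ≤ Y)
        = insert U (Finset.univ.filter fun Y => U < Y) := by
      ext Y
      simp [le_iff_eq_or_lt, eq_comm]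
    have hU := h U le_rfl
    rw [hs, Finset.sum_insert (by simp), Finset.sum_insert (by simp)] at hU
    have : ∑ Y with U < Y, f Y = ∑ Y with U < Y, g Y := by
      refine Finset.sum_congr rfl fun Y hY => ?_
      have hY : U < Y := by simpa using hY
      exact ih Y hY fun V hV => h V (hY.le.trans hV)
    rw [this] at hU
    exact add_right_cancel hU

theorem eq_of_forall_sum_le_eq {α A : Type*} [Fintype α] [PartialOrder α] [AddCommGroup A]
    {f g : α → A} (U : α)
    (h : ∀ V, V ≤ U → ∑ Y with Y ≤ V, f Y = ∑ Y with Y ≤ V, g Y) : f U = g U :=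
  eq_of_forall_sum_ge_eq (α := αᵒᵈ) (f := f) (g := g) U h

section
variable {K : Type u} {E : Type v} [Field K] [AddCommGroup E] [Module K E] {r : ℕ}

theorem comap_mkQ_le_comap_mkQ (T : Submodule K E) (A B : Submodule K (E ⧸ T)) :
    A.comap T.mkQ ≤ B.comap T.mkQ ↔ A ≤ B := by
  refine ⟨fun h => ?_, fun h => Submodule.comap_mono h⟩
  have := Submodule.map_mono (f := T.mkQ) h
  rwa [Submodule.map_comap_eq_of_surjective T.mkQ_surjective,
    Submodule.map_comap_eq_of_surjective T.mkQ_surjective] at this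

theorem comap_mkQ_bot (T : Submodule K E) : (⊥ : Submodule K (E ⧸ T)).comap T.mkQ = T := by
  rw [Submodule.comap_bot, Submodule.ker_mkQ]

theorem ell_contract [FiniteDimensional K E] (M : QPolymatroid K E r) (T : Submodule K E)
    (X : Submodule K (E ⧸ T)) : (M.contract T).ell X = M.ell (X.comap T.mkQ) := by
  have h := M.rk_mono _ _ (le_comap_mkQ T X)
  change M.rk (Submodule.comap T.mkQ ⊤) - M.rk T - (M.rk (X.comap T.mkQ) - M.rk T) = M.rk ⊤ - _
  rw [Submodule.comap_top]
  omega

end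

variable {K : Type u} {E : Type v} [Field K] [Finite K] [AddCommGroup E] [Module K E]
  [FiniteDimensional K E]

theorem sum_quotient {A : Type*} [AddCommMonoid A] (T : Submodule K E) (f : Submodule K E → A) :
    ∑ X : Submodule K (E ⧸ T), f (X.comap T.mkQ) = ∑ X with T ≤ X, f X := by
  refine Finset.sum_bij' (fun X _ => X.comap T.mkQ) (fun X _ => X.map T.mkQ) ?_ ?_ ?_ ?_ ?_
  · intro X _
    simpa using le_comap_mkQ T X
  · simp
  · intro X _
    exact Submodule.map_comap_eq_of_surjective T.mkQ_surjective X
  · intro X hX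
    have hX : T ≤ X := by simpa using hX
    rw [Submodule.comap_map_mkQ, sup_eq_right.2 hX]
  · simp

theorem sum_moebius_right (U V : Submodule K E) :
    ∑ X with U ≤ X ∧ X ≤ V, moebius K E U X = if U = V then 1 else 0 := by
  have : Finite E := Module.finite_of_finite K
  let i1 : Fintype (Submodule K E) := Fintype.ofFinite _
  let i2 : LocallyFiniteOrder (Submodule K E) := Fintype.toLocallyFiniteOrder
  have h := IncidenceAlgebra.sum_Icc_mu_right (𝕜 := ℤ) U V
  rw [← h]
  refine Finset.sum_congr ?_ fun X _ => rfl
  ext X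
  simp

theorem sum_moebius_left (U V : Submodule K E) :
    ∑ X with U ≤ X ∧ X ≤ V, moebius K E X V = if U = V then 1 else 0 := by
  have : Finite E := Module.finite_of_finite K
  let i1 : Fintype (Submodule K E) := Fintype.ofFinite _
  let i2 : LocallyFiniteOrder (Submodule K E) := Fintype.toLocallyFiniteOrder
  have h := IncidenceAlgebra.sum_Icc_mu_left (𝕜 := ℤ) U V
  rw [← h]
  refine Finset.sum_congr ?_ fun X _ => rfl
  ext X
  simp

theorem moebius_quotient (T : Submodule K E) (X : Submodule K (E ⧸ T)) :
    moebius K (E ⧸ T) ⊥ X = moebius K E T (X.comap T.mkQ) := by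
  refine eq_of_forall_sum_le_eq (f := fun X => moebius K (E ⧸ T) ⊥ X)
    (g := fun X => moebius K E T (X.comap T.mkQ)) X fun V _ => ?_
  have h1 := sum_moebius_right (⊥ : Submodule K (E ⧸ T)) V
  simp only [bot_le, true_and] at h1
  have h2 := sum_moebius_right T (V.comap T.mkQ)
  rw [← Finset.filter_filter, Finset.sum_filter, ← sum_quotient T
    (fun X => if X ≤ V.comap T.mkQ then moebius K E T X else 0)] at h2
  simp only [comap_mkQ_le_comap_mkQ] at h2
  rw [h1, Finset.sum_filter, h2]
  refine if_congr ?_ rfl rfl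
  rw [← (Submodule.comap_injective_of_surjective T.mkQ_surjective).eq_iff, comap_mkQ_bot]

variable {F : Type w} [Field F] {r : ℕ}

/-- The value at `θ` of the characteristic polynomial of `M/Y`. -/
noncomputable def contractEval (M : QPolymatroid K E r) (θ : F) (Y : Submodule K E) : F :=
  Polynomial.aeval θ (M.contract Y).charPoly

theorem contractEval_eq (M : QPolymatroid K E r) (θ : F) (Y : Submodule K E) :
    contractEval M θ Y = ∑ X with Y ≤ X, (moebius K E Y X : F) * θ ^ M.ell X := by
  rw [contractEval, charPoly, finsum_eq_sum_of_fintype, map_sum, ← sum_quotient]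
  refine Finset.sum_congr rfl fun X _ => ?_
  rw [moebius_quotient, ell_contract]
  simp

theorem sum_contractEval (M : QPolymatroid K E r) (θ : F) (U : Submodule K E) :
    ∑ Y with U ≤ Y, contractEval M θ Y = θ ^ M.ell U := by
  simp only [contractEval_eq, Finset.sum_filter]
  have : ∀ Y : Submodule K E, (if U ≤ Y then
      ∑ X, if Y ≤ X then (moebius K E Y X : F) * θ ^ M.ell X else 0 else 0) =
      ∑ X, if U ≤ Y ∧ Y ≤ X then (moebius K E Y X : F) * θ ^ M.ell X else 0 := by
    intro Y
    split_ifs with h <;> simp [h]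
  simp only [this]
  rw [Finset.sum_comm]
  have h2 : ∀ X : Submodule K E,
      (∑ Y, if U ≤ Y ∧ Y ≤ X then (moebius K E Y X : F) * θ ^ M.ell X else 0) =
      (if U = X then 1 else 0) * θ ^ M.ell X := by
    intro X
    have h := congrArg (Int.cast : ℤ → F) (sum_moebius_left U X)
    rw [Int.cast_sum, Finset.sum_filter] at h
    push_cast at h
    rw [← h, Finset.sum_mul]
    refine Finset.sum_congr rfl fun Y _ => ?_
    split_ifs <;> simp
  simp [h2]

/-- The two contractions live on different quotient spaces; comparing up-sums avoids an explicit
isomorphism between them. -/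
theorem contractEval_contract (M : QPolymatroid K E r) (θ : F) (T : Submodule K E)
    (Y : Submodule K (E ⧸ T)) :
    contractEval (M.contract T) θ Y = contractEval M θ (Y.comap T.mkQ) := by
  refine eq_of_forall_sum_ge_eq (f := fun Y => contractEval (M.contract T) θ Y)
    (g := fun Y => contractEval M θ (Y.comap T.mkQ)) Y fun V _ => ?_
  rw [sum_contractEval, ell_contract, ← sum_contractEval, Finset.sum_filter (p := fun Y => V ≤ Y)]
  simp only [← comap_mkQ_le_comap_mkQ]
  rw [sum_quotient T (fun Y => if V.comap T.mkQ ≤ Y then contractEval M θ Y else 0),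
    ← Finset.sum_filter, Finset.filter_filter]
  refine Finset.sum_congr ?_ fun _ _ => rfl
  ext X
  simpa using fun h => (le_comap_mkQ T V).trans h

theorem aeval_weightEnum (M : QPolymatroid K E r) (θ : F) (i : ℕ) :
    Polynomial.aeval θ (M.weightEnum i) =
      ∑ Y with finrank K (Y : Submodule K E) + i = finrank K E, contractEval M θ Y := by
  rw [weightEnum, finsum_eq_sum_of_fintype, map_sum, Finset.sum_filter]
  refine Finset.sum_congr rfl fun Y _ => ?_
  split_ifs with h <;> simp [h, contractEval]

theorem aeval_weightEnum_contract (M : QPolymatroid K E r) (θ : F) (T : Submodule K E) (i : ℕ) :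
    Polynomial.aeval θ ((M.contract T).weightEnum i) =
      ∑ Y with T ≤ Y ∧ finrank K (Y : Submodule K E) + i = finrank K E, contractEval M θ Y := by
  rw [aeval_weightEnum, Finset.sum_filter, ← Finset.filter_filter, Finset.sum_filter,
    ← sum_quotient]
  refine Finset.sum_congr rfl fun Y _ => ?_
  rw [contractEval_contract]
  refine if_congr ?_ rfl rfl
  rw [finrank_comap_mkQ]
  have := T.finrank_quotient_add_finrank
  omega

theorem contractEval_top (M : QPolymatroid K E r) (θ : F) : contractEval M θ ⊤ = 1 := by
  have h := sum_contractEval M θ ⊤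
  simpa [Finset.filter_eq, ell, top_le_iff, Finset.sum_filter] using h

end

/-! ### Vandermonde systems and counting by linear automorphisms -/

section
open scoped Classical
open QPolymatroid

theorem eq_zero_of_forall_sum_mul_pow_eq_zero {F : Type w} [Field F] (J : Finset ℕ) (D c : ℕ → F)
    (hc : Set.InjOn c J) (h : ∀ m < J.card, ∑ j ∈ J, D j * c j ^ m = 0) : ∀ j ∈ J, D j = 0 := by
  intro j hj
  have key := Matrix.eq_zero_of_forall_pow_sum_mul_pow_eq_zero
    (f := fun i : Fin J.card => c (J.equivFin.symm i))
    (v := fun i : Fin J.card => D (J.equivFin.symm i))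
    (fun a b hab => J.equivFin.symm.injective (Subtype.ext (hc (J.equivFin.symm a).2
      (J.equivFin.symm b).2 hab))) (fun i => by
        rw [← h i i.2, ← Finset.sum_coe_sort J]
        exact Equiv.sum_comp J.equivFin.symm (fun j : J => D j * c j ^ (i : ℕ)))
  simpa using congrFun key (J.equivFin ⟨j, hj⟩)

section
variable {K : Type u} {E : Type v} [Field K] [AddCommGroup E] [Module K E] [FiniteDimensional K E]

theorem Submodule.exists_linearEquiv_map_eq {W W' : Submodule K E}
    (h : finrank K W = finrank K W') : ∃ g : E ≃ₗ[K] E, W.map (g : E →ₗ[K] E) = W' := by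
  obtain ⟨g, hg⟩ := Submodule.exists_linearEquiv_restrict_eq (LinearEquiv.ofFinrankEq W W' h)
  refine ⟨g, Submodule.eq_of_le_of_finrank_eq ?_ ?_⟩
  · rintro _ ⟨x, hx, rfl⟩
    have := hg ⟨x, hx⟩
    simp only [LinearEquiv.coe_coe]
    rw [← this]
    exact Subtype.property _
  · rw [← h]
    exact LinearEquiv.finrank_map_eq g W

/-- `GL(E)` is transitive on flags of given dimensions: move `Y` first, then correct inside `Y'` by
an automorphism of `Y'` extended to `E`. -/
theorem Submodule.exists_linearEquiv_map_eq_map_eq {T Y T' Y' : Submodule K E} (hTY : T ≤ Y)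
    (hTY' : T' ≤ Y') (hT : finrank K T = finrank K T') (hY : finrank K Y = finrank K Y') :
    ∃ g : E ≃ₗ[K] E, T.map (g : E →ₗ[K] E) = T' ∧ Y.map (g : E →ₗ[K] E) = Y' := by
  obtain ⟨g, hg⟩ := Submodule.exists_linearEquiv_map_eq hY
  have hle : T.map (g : E →ₗ[K] E) ≤ Y' := hg ▸ Submodule.map_mono hTY
  have hd : finrank K ((T.map (g : E →ₗ[K] E)).comap Y'.subtype) =
      finrank K (T'.comap Y'.subtype) := by
    rw [(Submodule.comapSubtypeEquivOfLe hle).finrank_eq,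
      (Submodule.comapSubtypeEquivOfLe hTY').finrank_eq, ← hT]
    exact LinearEquiv.finrank_map_eq g T
  obtain ⟨f, hf⟩ := Submodule.exists_linearEquiv_map_eq hd
  obtain ⟨k, hk⟩ := Submodule.exists_linearEquiv_restrict_eq f
  have hmem : ∀ x ∈ Y', k x ∈ Y' := fun x hx => by
    rw [← hk ⟨x, hx⟩]
    exact Subtype.property _
  refine ⟨g.trans k, Submodule.eq_of_le_of_finrank_eq ?_ ?_,
    Submodule.eq_of_le_of_finrank_eq ?_ ?_⟩
  · rintro _ ⟨x, hx, rfl⟩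
    have hx' : g x ∈ Y' := hle ⟨x, hx, rfl⟩
    have h1 : f ⟨g x, hx'⟩ ∈ T'.comap Y'.subtype := by
      rw [← hf]
      exact ⟨⟨g x, hx'⟩, ⟨x, hx, rfl⟩, rfl⟩
    have h2 : ((f ⟨g x, hx'⟩ : Y') : E) ∈ T' := h1
    rwa [hk] at h2
  · rw [← hT]
    exact LinearEquiv.finrank_map_eq (g.trans k) T
  · rintro _ ⟨x, hx, rfl⟩
    exact hmem _ (hg ▸ ⟨x, hx, rfl⟩)
  · rw [← hY]
    exact LinearEquiv.finrank_map_eq (g.trans k) Y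

/-- An automorphism taking `T` to `T'` permutes the tuples and preserves dimensions. -/
theorem sum_tuple_finrank_sup_span [Fintype E] {A : Type*} [AddCommMonoid A] (h : ℕ → A) (m : ℕ)
    {T T' : Submodule K E} (hT : finrank K T = finrank K T') :
    ∑ x : Fin m → E, h (finrank K (T ⊔ Submodule.span K (Set.range x) : Submodule K E)) =
      ∑ x : Fin m → E, h (finrank K (T' ⊔ Submodule.span K (Set.range x) : Submodule K E)) := by
  obtain ⟨g, rfl⟩ := Submodule.exists_linearEquiv_map_eq hT
  symm
  rw [← Equiv.sum_comp ((Equiv.refl (Fin m)).arrowCongr g.toEquiv)]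
  refine Finset.sum_congr rfl fun x _ => ?_
  have : Set.range ((Equiv.refl (Fin m)).arrowCongr g.toEquiv x) =
      (g : E →ₗ[K] E) '' Set.range x := by
    rw [← Set.range_comp]
    rfl
  rw [this, ← Submodule.map_span, ← Submodule.map_sup, LinearEquiv.finrank_map_eq]

theorem sum_tuple_mem_finrank_span [Fintype E] {A : Type*} [AddCommMonoid A] (h : ℕ → A) (m : ℕ)
    {T T' : Submodule K E} (hT : finrank K T = finrank K T') :
    ∑ x : Fin m → E with ∀ i, x i ∈ T, h (finrank K (Submodule.span K (Set.range x))) =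
      ∑ x : Fin m → E with ∀ i, x i ∈ T', h (finrank K (Submodule.span K (Set.range x))) := by
  obtain ⟨g, rfl⟩ := Submodule.exists_linearEquiv_map_eq hT
  symm
  rw [Finset.sum_filter, Finset.sum_filter,
    ← Equiv.sum_comp ((Equiv.refl (Fin m)).arrowCongr g.toEquiv)]
  refine Finset.sum_congr rfl fun x _ => ?_
  have : Set.range ((Equiv.refl (Fin m)).arrowCongr g.toEquiv x) =
      (g : E →ₗ[K] E) '' Set.range x := by
    rw [← Set.range_comp]
    rfl
  rw [this, ← Submodule.map_span, LinearEquiv.finrank_map_eq]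
  refine if_congr (forall_congr' fun i => ?_) rfl rfl
  change g (x i) ∈ T.map (g : E →ₗ[K] E) ↔ _
  simp

theorem card_filter_mem [Fintype E] (Y : Submodule K E) :
    (Finset.univ.filter (· ∈ Y)).card = Nat.card K ^ finrank K Y := by
  rw [← Module.natCard_eq_pow_finrank, Nat.card_eq_fintype_card, Fintype.card_subtype]

theorem card_tuple_mem [Fintype E] (m : ℕ) (Y : Submodule K E) :
    (Finset.univ.filter (fun x : Fin m → E => ∀ i, x i ∈ Y)).card =
      (Nat.card K ^ finrank K Y) ^ m := by
  rw [← card_filter_mem]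
  have : (Finset.univ.filter (fun x : Fin m → E => ∀ i, x i ∈ Y)) =
      Fintype.piFinset fun _ => Finset.univ.filter (· ∈ Y) := by
    ext x
    simp
  rw [this]
  simp

theorem finrank_sup_span_range_le (T : Submodule K E) {m : ℕ} (x : Fin m → E) :
    finrank K (T ⊔ Submodule.span K (Set.range x) : Submodule K E) ≤ finrank K T + m := by
  have h1 := Submodule.finrank_add_le_finrank_add_finrank T (Submodule.span K (Set.range x))
  have h2 := finrank_range_le_card (R := K) x
  rw [Fintype.card_fin] at h2
  exact h1.trans (Nat.add_le_add_left h2 _)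

variable [Finite K]

theorem card_between_eq (m : ℕ) {T Y T' Y' : Submodule K E} (hTY : T ≤ Y)
    (hTY' : T' ≤ Y') (hT : finrank K T = finrank K T') (hY : finrank K Y = finrank K Y') :
    (Finset.univ.filter fun U : Submodule K E => T ≤ U ∧ U ≤ Y ∧ finrank K U = m).card =
      (Finset.univ.filter fun U : Submodule K E => T' ≤ U ∧ U ≤ Y' ∧ finrank K U = m).card := by
  obtain ⟨g, rfl, rfl⟩ := Submodule.exists_linearEquiv_map_eq_map_eq hTY hTY' hT hY
  refine Finset.card_equiv (Submodule.orderIsoMapComap g).toEquiv fun U => ?_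
  have h : finrank K ((Submodule.orderIsoMapComap g) U) = finrank K U :=
    LinearEquiv.finrank_map_eq g U
  have h1 : ∀ A B : Submodule K E, A.map (g : E →ₗ[K] E) ≤ B.map (g : E →ₗ[K] E) ↔ A ≤ B :=
    fun A B => (Submodule.orderIsoMapComap g).le_iff_le
  simp only [Finset.mem_filter, Finset.mem_univ, true_and]
  change _ ↔ _ ∧ _ ∧ finrank K ((Submodule.orderIsoMapComap g) U) = m
  rw [h]
  change _ ↔ T.map (g : E →ₗ[K] E) ≤ U.map (g : E →ₗ[K] E) ∧
    U.map (g : E →ₗ[K] E) ≤ Y.map (g : E →ₗ[K] E) ∧ _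
  rw [h1, h1]

/-- The counts are Gaussian binomials, but only their dependence on dimensions is needed. The value
0 is a filler for dimensions that no pair realises. -/
theorem exists_card_between (t m : ℕ) : ∃ c : ℕ → ℕ, ∀ T Y : Submodule K E, T ≤ Y →
    finrank K T = t →
    (Finset.univ.filter fun U : Submodule K E => T ≤ U ∧ U ≤ Y ∧ finrank K U = m).card =
      c (finrank K Y) := by
  have : ∀ y : ℕ, ∃ c : ℕ, ∀ T Y : Submodule K E, T ≤ Y → finrank K T = t → finrank K Y = y →
      (Finset.univ.filter fun U : Submodule K E => T ≤ U ∧ U ≤ Y ∧ finrank K U = m).card = c := by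
    intro y
    by_cases h : ∃ T Y : Submodule K E, T ≤ Y ∧ finrank K T = t ∧ finrank K Y = y
    · obtain ⟨T, Y, hTY, hT, hY⟩ := h
      exact ⟨_, fun T' Y' h' hT' hY' => card_between_eq m h' hTY (hT'.trans hT.symm)
        (hY'.trans hY.symm)⟩
    · exact ⟨0, fun T' Y' h' hT' hY' => absurd ⟨T', Y', h', hT', hY'⟩ h⟩
  choose c hc using this
  exact ⟨c, fun T Y h hT => hc _ T Y h hT rfl⟩

theorem exists_card_above (m : ℕ) : ∃ c : ℕ → ℕ, ∀ T : Submodule K E,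
    (Finset.univ.filter fun U : Submodule K E => T ≤ U ∧ finrank K U = m).card =
      c (finrank K T) := by
  have : ∀ t : ℕ, ∃ c : ℕ → ℕ, ∀ T Y : Submodule K E, T ≤ Y → finrank K T = t →
    (Finset.univ.filter fun U : Submodule K E => T ≤ U ∧ U ≤ Y ∧ finrank K U = m).card =
      c (finrank K Y) := fun t => exists_card_between t m
  choose c hc using this
  refine ⟨fun t => c t (finrank K E), fun T => ?_⟩
  have h := hc (finrank K T) T ⊤ le_top rfl
  rw [finrank_top] at h
  simpa using h

end

end

/-! ### Moment identities for the weight enumerators of contractions -/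

section
open scoped Classical
open QPolymatroid

variable {K : Type u} {E : Type v} [Field K] [Finite K] [AddCommGroup E] [Module K E]
  [FiniteDimensional K E] {F : Type w} [Field F] {r : ℕ}

/-- The weight enumerator `A_{M/T}(j; θ)`, written as a sum over subspaces of `E`. -/
noncomputable def weightAbove (M : QPolymatroid K E r) (θ : F) (T : Submodule K E) (j : ℕ) : F :=
  ∑ Y with T ≤ Y ∧ finrank K (Y : Submodule K E) + j = finrank K E, contractEval M θ Y

theorem weightAbove_zero (M : QPolymatroid K E r) (θ : F) (T : Submodule K E) :
    weightAbove M θ T 0 = 1 := by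
  have : (Finset.univ.filter fun Y : Submodule K E => T ≤ Y ∧ finrank K Y + 0 = finrank K E) =
      {⊤} := by
    ext Y
    simp only [add_zero, Finset.mem_filter, Finset.mem_univ, true_and, Finset.mem_singleton]
    constructor
    · exact fun h => Submodule.eq_top_of_finrank_eq h.2
    · rintro rfl
      exact ⟨le_top, finrank_top K E⟩
  rw [weightAbove, this, Finset.sum_singleton, contractEval_top]

theorem weightAbove_eq_zero (M : QPolymatroid K E r) (θ : F) {T : Submodule K E} {j : ℕ}
    (h : finrank K E < finrank K T + j) : weightAbove M θ T j = 0 := by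
  refine Finset.sum_eq_zero fun Y hY => ?_
  simp only [Finset.mem_filter, Finset.mem_univ, true_and] at hY
  have := Submodule.finrank_mono hY.1
  omega

theorem sum_contractEval_mul (M : QPolymatroid K E r) (θ : F) (T : Submodule K E) (c : ℕ → F) :
    ∑ Y with T ≤ Y, contractEval M θ Y * c (finrank K Y) =
      ∑ j ∈ Finset.range (finrank K E + 1), weightAbove M θ T j * c (finrank K E - j) := by
  rw [← Finset.sum_fiberwise_of_maps_to (s := Finset.univ.filter fun Y : Submodule K E => T ≤ Y)
    (t := Finset.range (finrank K E + 1)) (g := fun Y => finrank K E - finrank K Y)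
    (fun Y _ => by simp)]
  refine Finset.sum_congr rfl fun j hj => ?_
  rw [weightAbove, Finset.sum_mul, Finset.filter_filter]
  refine Finset.sum_congr ?_ fun Y hY => ?_
  · ext Y
    have := Submodule.finrank_le Y
    simp only [Finset.mem_range] at hj
    simp only [Finset.mem_filter, Finset.mem_univ, true_and]
    refine and_congr_right fun _ => ?_
    omega
  · simp only [Finset.mem_filter, Finset.mem_univ, true_and] at hY
    congr 2
    omega

/-- Expand each power of `θ` as an up-sum and exchange the sums: `Y ≥ T` is counted once for each
`m`-tuple in `Y`. -/
theorem sum_tuple_pow_ell [Fintype E] (M : QPolymatroid K E r) (θ : F) (T : Submodule K E)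
    (m : ℕ) :
    ∑ x : Fin m → E, θ ^ M.ell (T ⊔ Submodule.span K (Set.range x)) =
      ∑ j ∈ Finset.range (finrank K E + 1),
        weightAbove M θ T j * ((Nat.card K : F) ^ (finrank K E - j)) ^ m := by
  rw [← sum_contractEval_mul M θ T fun k => ((Nat.card K : F) ^ k) ^ m]
  simp only [← sum_contractEval, Finset.sum_filter]
  rw [Finset.sum_comm]
  refine Finset.sum_congr rfl fun Y _ => ?_
  rw [← Finset.sum_filter, Finset.sum_const, nsmul_eq_mul]
  split_ifs with h
  · have := card_tuple_mem m Y
    have hs : (Finset.univ.filter fun x : Fin m → E => T ⊔ Submodule.span K (Set.range x) ≤ Y) =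
        Finset.univ.filter fun x : Fin m → E => ∀ i, x i ∈ Y := by
      ext x
      simp [h, Submodule.span_le, Set.range_subset_iff]
    rw [hs, this, mul_comm]
    push_cast
    rfl
  · rw [Finset.filter_false_of_mem fun x _ hx => h (le_sup_left.trans hx)]
    simp

/-- The same exchange with subspaces of dimension `m` in place of tuples; `c` counts those between
`T` and `Y`. -/
theorem sum_above_pow_ell (M : QPolymatroid K E r) (θ : F) (t m : ℕ) :
    ∃ c : ℕ → F, ∀ T : Submodule K E, finrank K T = t →
      ∑ U with T ≤ U ∧ finrank K U = m, θ ^ M.ell U =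
        ∑ j ∈ Finset.range (finrank K E + 1), weightAbove M θ T j * c (finrank K E - j) := by
  obtain ⟨c, hc⟩ := exists_card_between (K := K) (E := E) t m
  refine ⟨fun k => (c k : F), fun T hT => ?_⟩
  rw [← sum_contractEval_mul M θ T fun k => (c k : F)]
  simp only [← sum_contractEval]
  rw [Finset.sum_congr rfl fun U _ => Finset.sum_filter _ _, Finset.sum_comm,
    Finset.sum_filter (p := fun Y => T ≤ Y)]
  refine Finset.sum_congr rfl fun Y _ => ?_
  rw [← Finset.sum_filter, Finset.sum_const, nsmul_eq_mul, Finset.filter_filter]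
  split_ifs with h
  · rw [← hc T Y h hT, mul_comm]
    congr 3
    ext U
    simp only [Finset.mem_filter, Finset.mem_univ, true_and]
    tauto
  · rw [Finset.filter_false_of_mem fun x _ hx => h (hx.1.1.trans hx.2)]
    simp

section
variable [CharZero F] {N : QMatroid K E} {d t : ℕ} {θ : F} {J : Finset ℕ}

variable (K) in
theorem injOn_cast_card_pow (n : ℕ) :
    Set.InjOn (fun j => (Nat.card K : F) ^ (n - j)) (Finset.range (n + 1)) := by
  intro a ha b hb hab
  simp only [Finset.coe_range, Set.mem_Iio] at ha hb
  have h2 : ((Nat.card K ^ (n - a) : ℕ) : F) = (Nat.card K ^ (n - b) : ℕ) := by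
    push_cast
    exact hab
  have := Nat.pow_right_injective (Finite.one_lt_card (α := K)) (Nat.cast_injective h2)
  omega

theorem weightAbove_eq_of_card_le (hd : ∀ A : Submodule K E, finrank K A < d → N.rk A = finrank K A)
    (hJ : J.card ≤ d - t) (hJn : J ⊆ Finset.range (finrank K E + 1))
    (h0 : ∀ T : Submodule K E, finrank K T = t → ∀ j, j ≠ 0 → j ∉ J → weightAbove N θ T j = 0)
    {T T' : Submodule K E} (hT : finrank K T = t) (hT' : finrank K T' = t) (j : ℕ) :
    weightAbove N θ T j = weightAbove N θ T' j := by
  have : Finite E := Module.finite_of_finite K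
  have := Fintype.ofFinite E
  have hoff : ∀ j, j ∉ J → weightAbove N θ T j - weightAbove N θ T' j = 0 := by
    intro j hj
    rcases eq_or_ne j 0 with rfl | hj0
    · rw [weightAbove_zero, weightAbove_zero, sub_self]
    · rw [h0 T hT j hj0 hj, h0 T' hT' j hj0 hj, sub_self]
  by_cases hj : j ∈ J
  swap
  · exact sub_eq_zero.1 (hoff j hj)
  refine sub_eq_zero.1 (eq_zero_of_forall_sum_mul_pow_eq_zero J
    (fun j => weightAbove N θ T j - weightAbove N θ T' j) _
    ((injOn_cast_card_pow K (finrank K E)).mono hJn) (fun m hm => ?_) j hj)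
  -- The term `j = 0` drops out of the difference because it is 1 for both spaces.
  rw [Finset.sum_subset hJn fun j _ hj => by rw [hoff j hj, zero_mul]]
  simp only [sub_mul, Finset.sum_sub_distrib]
  rw [← sum_tuple_pow_ell, ← sum_tuple_pow_ell, sub_eq_zero]
  have key : ∀ S : Submodule K E, finrank K S = t →
      ∑ x : Fin m → E, θ ^ N.ell (S ⊔ Submodule.span K (Set.range x)) =
      ∑ x : Fin m → E, (fun k => θ ^ (N.rk ⊤ - k))
        (finrank K (S ⊔ Submodule.span K (Set.range x) : Submodule K E)) := by
    intro S hS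
    refine Finset.sum_congr rfl fun x _ => ?_
    have := finrank_sup_span_range_le S x
    simp only [ell]
    rw [hd (S ⊔ Submodule.span K (Set.range x)) (by omega)]
  rw [key T hT, key T' hT']
  exact sum_tuple_finrank_sup_span (fun k => θ ^ (N.rk ⊤ - k)) m (hT.trans hT'.symm)

/-- If the rank exceeded `d`, then `T` with at most `d - t` further vectors would never span, so at
`θ = 0` the first `|J| + 1` moments would vanish. Vandermonde on `J ∪ {0}` would then kill the
coefficient at 0, which is 1. -/
theorem rk_top_le_of_zero
    (htd : t < d) (hJ : J.card ≤ d - t) (hJn : J ⊆ Finset.range (finrank K E + 1))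
    {T : Submodule K E} (hT : finrank K T = t)
    (h0 : ∀ j, j ≠ 0 → j ∉ J → weightAbove N (0 : F) T j = 0) : N.rk ⊤ ≤ d := by
  have : Finite E := Module.finite_of_finite K
  have := Fintype.ofFinite E
  by_contra! hlt
  have hsub : insert 0 J ⊆ Finset.range (finrank K E + 1) :=
    Finset.insert_subset (by simp) hJn
  refine one_ne_zero (α := F) ?_
  rw [← weightAbove_zero N (0 : F) T]
  refine eq_zero_of_forall_sum_mul_pow_eq_zero (insert 0 J) (weightAbove N (0 : F) T) _
    ((injOn_cast_card_pow K (finrank K E)).mono hsub) (fun m hm => ?_) 0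
    (Finset.mem_insert_self _ _)
  rw [Finset.sum_subset hsub fun j _ hj => by
    rw [Finset.mem_insert, not_or] at hj
    rw [h0 j hj.1 hj.2, zero_mul], ← sum_tuple_pow_ell]
  refine Finset.sum_eq_zero fun x _ => zero_pow ?_
  have h1 := finrank_sup_span_range_le T x
  have h2 := Finset.card_insert_le 0 J
  have h3 := N.rk_le (T ⊔ Submodule.span K (Set.range x))
  simp only [ell]
  omega

theorem sum_above_pow_nullity_eq
    (hd : ∀ A : Submodule K E, finrank K A < d → N.rk A = finrank K A)
    (htd : t < d) (hJ : J.card ≤ d - t) (hJn : J ⊆ Finset.range (finrank K E + 1))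
    (h0 : ∀ T : Submodule K E, finrank K T = t → ∀ j, j ≠ 0 → j ∉ J → weightAbove N θ T j = 0)
    {T T' : Submodule K E} (hT : finrank K T = t) (hT' : finrank K T' = t) (m : ℕ) :
    ∑ U with T ≤ U ∧ finrank K U = m, θ ^ (finrank K U - N.rk U) =
      ∑ U with T' ≤ U ∧ finrank K U = m, θ ^ (finrank K U - N.rk U) := by
  have hell : ∑ U with T ≤ U ∧ finrank K U = m, θ ^ N.ell U =
      ∑ U with T' ≤ U ∧ finrank K U = m, θ ^ N.ell U := by
    obtain ⟨c, hc⟩ := sum_above_pow_ell N θ t m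
    rw [hc T hT, hc T' hT']
    simp only [weightAbove_eq_of_card_le hd hJ hJn h0 hT hT']
  have hle : ∀ U : Submodule K E, N.rk U ≤ finrank K U := fun U => by simpa using N.rk_le U
  have hmono : ∀ U : Submodule K E, N.rk U ≤ N.rk ⊤ := fun U => N.rk_mono _ _ le_top
  have hconst : ∀ a : F, (∀ U : Submodule K E, finrank K U = m →
      θ ^ (finrank K U - N.rk U) = a) →
      ∑ U with T ≤ U ∧ finrank K U = m, θ ^ (finrank K U - N.rk U) =
      ∑ U with T' ≤ U ∧ finrank K U = m, θ ^ (finrank K U - N.rk U) := by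
    intro a ha
    obtain ⟨c, hc⟩ := exists_card_above (K := K) (E := E) m
    have key : ∀ S : Submodule K E,
        ∑ U with S ≤ U ∧ finrank K U = m, θ ^ (finrank K U - N.rk U) = c (finrank K S) * a := by
      intro S
      rw [← hc S, ← nsmul_eq_mul, ← Finset.sum_const]
      refine Finset.sum_congr rfl fun U hU => ha U ?_
      simp only [Finset.mem_filter, Finset.mem_univ, true_and] at hU
      exact hU.2
    rw [key, key, hT, hT']
  -- For fixed `m` the nullity and `ell` differ by a constant, which is harmless when `θ` is
  -- invertible. At `θ = 0` the powers are constant for `m < d` and for `m > rk ⊤`; otherwise `rk ⊤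
  -- ≤ d` forces `m = rk ⊤`, where the two exponents agree.
  rcases eq_or_ne θ 0 with rfl | hθ
  · rcases lt_or_ge m d with hmd | hmd
    · refine hconst 1 fun U hU => ?_
      rw [hd U (hU ▸ hmd), Nat.sub_self, pow_zero]
    · rcases lt_or_ge (N.rk ⊤) m with hm | hm
      · refine hconst 0 fun U hU => zero_pow ?_
        have := hmono U
        omega
      · have := rk_top_le_of_zero htd hJ hJn hT (h0 T hT)
        have key : ∀ S : Submodule K E,
            ∑ U with S ≤ U ∧ finrank K U = m, (0 : F) ^ (finrank K U - N.rk U) =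
            ∑ U with S ≤ U ∧ finrank K U = m, (0 : F) ^ N.ell U := by
          intro S
          refine Finset.sum_congr rfl fun U hU => ?_
          simp only [Finset.mem_filter, Finset.mem_univ, true_and] at hU
          rw [hU.2, ell]
          congr 2
          omega
        rw [key, key, hell]
  · have key : ∀ S : Submodule K E,
        (∑ U with S ≤ U ∧ finrank K U = m, θ ^ (finrank K U - N.rk U)) * θ ^ N.rk ⊤ =
        (∑ U with S ≤ U ∧ finrank K U = m, θ ^ N.ell U) * θ ^ m := by
      intro S
      rw [Finset.sum_mul, Finset.sum_mul]
      refine Finset.sum_congr rfl fun U hU => ?_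
      simp only [Finset.mem_filter, Finset.mem_univ, true_and] at hU
      rw [← pow_add, ← pow_add, ell]
      congr 1
      have := hle U
      have := hmono U
      omega
    exact mul_right_cancel₀ (pow_ne_zero _ hθ) ((key T).trans (by rw [hell, ← key T']))

end

end

/-! ### Weighted subspace designs, their duals and intersection numbers -/

section
open scoped Classical
open QPolymatroid

theorem card_mem_notMem {K : Type u} {E : Type v} [Field K] [AddCommGroup E] [Module K E]
    [FiniteDimensional K E] {F : Type w} [Field F] [Fintype E] (A B : Submodule K E) :
    ((Finset.univ.filter fun x => x ∈ A ∧ x ∉ B).card : F) =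
      (Nat.card K : F) ^ finrank K A - (Nat.card K : F) ^ finrank K (A ⊓ B : Submodule K E) := by
  have h1 := card_filter_mem A
  have h2 := card_filter_mem (A ⊓ B)
  have h3 := Finset.card_filter_add_card_filter_not (s := Finset.univ.filter (· ∈ A)) (· ∈ B)
  rw [Finset.filter_filter, Finset.filter_filter, h1] at h3
  simp only [Submodule.mem_inf] at h2
  rw [h2] at h3
  rw [eq_sub_iff_add_eq, add_comm, ← Nat.cast_pow, ← Nat.cast_pow, ← Nat.cast_add, h3]

variable {K : Type u} {E : Type v} [Field K] [Finite K] [AddCommGroup E] [Module K E]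
  [FiniteDimensional K E] {F : Type w} [Field F]

/-- Double count of pairs `(C, x)` with `x` in `C` outside `B`. -/
theorem sum_between_mul_card [Fintype E] (w : Submodule K E → F) (S V B : Submodule K E) :
    ∑ C with S ≤ C ∧ C ≤ V, w C * ((Finset.univ.filter fun x => x ∈ C ∧ x ∉ B).card : F) =
      ∑ x with x ∈ V ∧ x ∉ B, ∑ C with S ⊔ K ∙ x ≤ C ∧ C ≤ V, w C := by
  have h1 : ∀ C : Submodule K E, w C * ((Finset.univ.filter fun x => x ∈ C ∧ x ∉ B).card : F) =
      ∑ x, if x ∈ C ∧ x ∉ B then w C else 0 := by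
    intro C
    rw [← Finset.sum_filter, Finset.sum_const, nsmul_eq_mul, mul_comm]
  simp only [h1]
  rw [Finset.sum_comm, Finset.sum_filter (p := fun x => x ∈ V ∧ x ∉ B)]
  refine Finset.sum_congr rfl fun x _ => ?_
  rw [← Finset.sum_filter, Finset.filter_filter]
  split_ifs with hx
  · refine Finset.sum_congr ?_ fun _ _ => rfl
    ext C
    simp only [Finset.mem_filter, Finset.mem_univ, true_and, sup_le_iff,
      Submodule.span_singleton_le_iff_mem]
    tauto
  · rw [Finset.filter_false_of_mem, Finset.sum_empty]
    rintro C - ⟨hC, hxC⟩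
    exact hx ⟨hC.2 hxC.1, hxC.2⟩

variable [CharZero F] {w : Submodule K E → F} {k t : ℕ}

variable (K F) in
theorem cast_card_pow_injective : Function.Injective fun j : ℕ => (Nat.card K : F) ^ j := by
  intro a b hab
  have h2 : ((Nat.card K ^ a : ℕ) : F) = (Nat.card K ^ b : ℕ) := by
    push_cast
    exact hab
  exact Nat.pow_right_injective (Finite.one_lt_card (α := K)) (Nat.cast_injective h2)

/-- Each block above `T` has `q^k - q^s` vectors outside `T`, and each of the `q^n - q^s` vectors
outside `T` extends it to dimension `s + 1`. -/
theorem exists_sum_above_eq_of_succ (hw : ∀ C, w C ≠ 0 → finrank K C = k) {s : ℕ} (hs : s < k)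
    (h : ∃ l, ∀ T : Submodule K E, finrank K T = s + 1 → ∑ C with T ≤ C, w C = l) :
    ∃ l, ∀ T : Submodule K E, finrank K T = s → ∑ C with T ≤ C, w C = l := by
  have : Finite E := Module.finite_of_finite K
  have := Fintype.ofFinite E
  obtain ⟨l, hl⟩ := h
  set q : F := (Nat.card K : F) with hq
  refine ⟨(q ^ finrank K E - q ^ s) * l / (q ^ k - q ^ s), fun T hT => ?_⟩
  have hne : q ^ k - q ^ s ≠ 0 :=
    sub_ne_zero.2 fun he => hs.ne' (cast_card_pow_injective K F he)
  rw [eq_div_iff hne]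
  have h1 := sum_between_mul_card w T ⊤ T
  have h2 : ∀ C : Submodule K E, T ≤ C →
      w C * ((Finset.univ.filter fun x => x ∈ C ∧ x ∉ T).card : F) =
      w C * (q ^ k - q ^ s) := by
    intro C hC
    rcases eq_or_ne (w C) 0 with h0 | h0
    · rw [h0, zero_mul, zero_mul]
    · rw [card_mem_notMem, inf_eq_right.2 hC, hw C h0, hT]
  simp only [le_top, and_true, Submodule.mem_top, true_and] at h1
  rw [Finset.sum_congr rfl fun C hC => h2 C (by simpa using hC), ← Finset.sum_mul] at h1
  rw [h1, Finset.sum_congr rfl fun x hx => hl (T ⊔ K ∙ x)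
    (by rw [Submodule.finrank_sup_span_singleton (by simpa using hx), hT]), Finset.sum_const,
    nsmul_eq_mul]
  congr 1
  have := card_mem_notMem (F := F) (⊤ : Submodule K E) T
  rw [top_inf_eq, finrank_top, hT] at this
  simpa using this

theorem exists_sum_above_eq_of_le (hw : ∀ C, w C ≠ 0 → finrank K C = k) (htk : t ≤ k)
    (h : ∃ l, ∀ T : Submodule K E, finrank K T = t → ∑ C with T ≤ C, w C = l) {s : ℕ}
    (hs : s ≤ t) :
    ∃ l, ∀ T : Submodule K E, finrank K T = s → ∑ C with T ≤ C, w C = l := by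
  induction hs using Nat.decreasingInduction with
  | of_succ s hs ih => exact exists_sum_above_eq_of_succ hw (by omega) ih
  | self => exact h

/-- Induction on the codimension `j` of `V`: enlarge `V` by one dimension to `W`, and count the
blocks in `W` that are not in `V` through their vectors outside `V`. -/
theorem exists_sum_between_eq (hw : ∀ C, w C ≠ 0 → finrank K C = k) (htk : t ≤ k)
    (h : ∃ l, ∀ T : Submodule K E, finrank K T = t → ∑ C with T ≤ C, w C = l) (j : ℕ) :
    ∀ i, i + j ≤ t → ∃ l, ∀ S V : Submodule K E, S ≤ V → finrank K S = i →
      finrank K V + j = finrank K E → ∑ C with S ≤ C ∧ C ≤ V, w C = l := by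
  have : Finite E := Module.finite_of_finite K
  have := Fintype.ofFinite E
  induction j with
  | zero =>
    intro i hi
    obtain ⟨l, hl⟩ := exists_sum_above_eq_of_le hw htk h (s := i) (by omega)
    refine ⟨l, fun S V _ hS hV => ?_⟩
    obtain rfl : V = ⊤ := Submodule.eq_top_of_finrank_eq hV
    simpa using hl S hS
  | succ j ih =>
    intro i hi
    obtain ⟨l₁, hl₁⟩ := ih i (by omega)
    obtain ⟨l₂, hl₂⟩ := ih (i + 1) (by omega)
    set q : F := (Nat.card K : F) with hq
    have hne : q ^ k - q ^ (k - 1) ≠ 0 := sub_ne_zero.2 fun he => by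
      have := cast_card_pow_injective K F he
      omega
    refine ⟨l₁ - (q ^ (finrank K E - j) - q ^ (finrank K E - j - 1)) * l₂ / (q ^ k - q ^ (k - 1)),
      fun S V hSV hS hV => ?_⟩
    obtain ⟨x, -, hx⟩ := SetLike.exists_of_lt (lt_top_iff_ne_top.2 (fun he : V = ⊤ => by
      rw [he, finrank_top] at hV
      omega))
    set W := V ⊔ K ∙ x with hWdef
    have hVW : V ≤ W := le_sup_left
    have hW : finrank K W = finrank K V + 1 := Submodule.finrank_sup_span_singleton hx
    have h1 := sum_between_mul_card w S W V
    have h2 : ∀ C : Submodule K E, C ≤ W →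
        w C * ((Finset.univ.filter fun x => x ∈ C ∧ x ∉ V).card : F) =
        (w C - if C ≤ V then w C else 0) * (q ^ k - q ^ (k - 1)) := by
      intro C hC
      rcases eq_or_ne (w C) 0 with h0 | h0
      · simp [h0]
      · rw [card_mem_notMem, hw C h0]
        split_ifs with hCV
        · rw [inf_eq_left.2 hCV, hw C h0]
          simp
        · rw [sub_zero]
          -- Here `C + V = W`, so `C ∩ V` has codimension 1 in `C`.
          have h3 := Submodule.finrank_sup_add_finrank_inf_eq C V
          have h4 : V < C ⊔ V := lt_of_le_of_ne le_sup_right fun he => hCV (by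
            rw [he]
            exact le_sup_left)
          have h5 := Submodule.finrank_lt_finrank_of_lt h4
          have h6 := Submodule.finrank_mono (sup_le hC hVW)
          rw [hw C h0] at h3
          congr 3
          omega
    rw [Finset.sum_congr rfl fun C hC => h2 C ((Finset.mem_filter.1 hC).2.2), ← Finset.sum_mul,
      Finset.sum_sub_distrib, hl₁ S W (hSV.trans hVW) hS (by omega), ← Finset.sum_filter,
      Finset.filter_filter] at h1
    have h7 : (Finset.univ.filter fun C => (S ≤ C ∧ C ≤ W) ∧ C ≤ V) =
        Finset.univ.filter fun C => S ≤ C ∧ C ≤ V := by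
      ext C
      simp only [Finset.mem_filter, Finset.mem_univ, true_and]
      exact ⟨fun h => ⟨h.1.1, h.2⟩, fun h => ⟨⟨h.1, h.2.trans hVW⟩, h.2⟩⟩
    have h8 : ∀ y, y ∈ W ∧ y ∉ V → ∑ C with S ⊔ K ∙ y ≤ C ∧ C ≤ W, w C = l₂ := by
      rintro y ⟨hyW, hyV⟩
      refine hl₂ _ _ (sup_le (hSV.trans hVW) ((Submodule.span_singleton_le_iff_mem _ _).2 hyW)) ?_
        (by omega)
      rw [Submodule.finrank_sup_span_singleton fun hyS => hyV (hSV hyS), hS]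
    rw [h7, Finset.sum_congr rfl fun y hy => h8 y (Finset.mem_filter.1 hy).2, Finset.sum_const,
      nsmul_eq_mul, card_mem_notMem, inf_eq_right.2 hVW, hW,
      show finrank K V + 1 = finrank K E - j by omega,
      show finrank K V = finrank K E - j - 1 by omega] at h1
    rw [← h1, mul_div_cancel_right₀ _ hne, sub_sub_cancel]

theorem exists_sum_below_eq (hw : ∀ C, w C ≠ 0 → finrank K C = k) (htk : t ≤ k)
    (h : ∃ l, ∀ T : Submodule K E, finrank K T = t → ∑ C with T ≤ C, w C = l) :
    ∃ l, ∀ V : Submodule K E, finrank K V + t = finrank K E → ∑ C with C ≤ V, w C = l := by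
  obtain ⟨l, hl⟩ := exists_sum_between_eq hw htk h t 0 (by omega)
  exact ⟨l, fun V hV => by simpa using hl ⊥ V bot_le (finrank_bot K E) hV⟩

/-- The `m`-th moment of `q^dim(C ∩ T)` counts blocks through the spans of `m`-tuples in `T`, which
the design property in dimensions at most `t` determines. As the powers of `q` are distinct in `F`,
the moments determine the whole distribution of `dim(C ∩ T)`. -/
theorem sum_mul_finrank_inf_eq (hw : ∀ C, w C ≠ 0 → finrank K C = k) (htk : t ≤ k)
    (h : ∃ l, ∀ T : Submodule K E, finrank K T = t → ∑ C with T ≤ C, w C = l) (f : ℕ → F)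
    {T T' : Submodule K E} (hT : finrank K T = t) (hT' : finrank K T' = t) :
    ∑ C, w C * f (finrank K (C ⊓ T : Submodule K E)) =
      ∑ C, w C * f (finrank K (C ⊓ T' : Submodule K E)) := by
  have : Finite E := Module.finite_of_finite K
  have := Fintype.ofFinite E
  set D : Submodule K E → ℕ → F := fun S e =>
    ∑ C with finrank K (C ⊓ S : Submodule K E) = e, w C with hD
  have hf : ∀ (S : Submodule K E) (f : ℕ → F),
      ∑ C, w C * f (finrank K (C ⊓ S : Submodule K E)) =
      ∑ e ∈ Finset.range (finrank K E + 1), D S e * f e := by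
    intro S f
    rw [← Finset.sum_fiberwise_of_maps_to (s := Finset.univ)
      (t := Finset.range (finrank K E + 1))
      (g := fun C : Submodule K E => finrank K (C ⊓ S : Submodule K E))
      (fun C _ => by simpa using Nat.lt_succ_of_le (Submodule.finrank_le _))]
    refine Finset.sum_congr rfl fun e _ => ?_
    rw [hD, Finset.sum_mul]
    refine Finset.sum_congr rfl fun C hC => ?_
    rw [(Finset.mem_filter.1 hC).2]
  have hl : ∀ s, ∃ l, s ≤ t → ∀ T : Submodule K E, finrank K T = s → ∑ C with T ≤ C, w C = l := by
    intro s
    by_cases hs : s ≤ t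
    · obtain ⟨l, hl⟩ := exists_sum_above_eq_of_le hw htk h hs
      exact ⟨l, fun _ => hl⟩
    · exact ⟨0, fun h => absurd h hs⟩
  choose l hl using hl
  have hpow : ∀ (m : ℕ) (S : Submodule K E), finrank K S = t →
      ∑ C, w C * (fun e => ((Nat.card K : F) ^ e) ^ m) (finrank K (C ⊓ S : Submodule K E)) =
      ∑ x : Fin m → E with ∀ i, x i ∈ S, l (finrank K (Submodule.span K (Set.range x))) := by
    intro m S hS
    have h1 : ∀ x : Fin m → E, (∀ i, x i ∈ S) → l (finrank K (Submodule.span K (Set.range x))) =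
        ∑ C with Submodule.span K (Set.range x) ≤ C, w C := by
      intro x hx
      have hle : Submodule.span K (Set.range x) ≤ S := by
        rw [Submodule.span_le]
        rintro _ ⟨i, rfl⟩
        exact hx i
      exact (hl _ (hS ▸ Submodule.finrank_mono hle) _ rfl).symm
    rw [Finset.sum_congr rfl fun x hx => h1 x (Finset.mem_filter.1 hx).2]
    simp only [Finset.sum_filter (p := fun C => _ ≤ C)]
    rw [Finset.sum_comm]
    refine Finset.sum_congr rfl fun C _ => ?_
    rw [← Finset.sum_filter, Finset.filter_filter, Finset.sum_const, nsmul_eq_mul, mul_comm]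
    congr 1
    have := card_tuple_mem m (C ⊓ S)
    rw [← Nat.cast_pow, ← Nat.cast_pow, ← this]
    congr 2
    ext x
    simp only [Finset.mem_filter, Finset.mem_univ, true_and, Submodule.mem_inf,
      Submodule.span_le, Set.range_subset_iff, SetLike.mem_coe]
    exact ⟨fun h => ⟨fun i => (h i).2, fun i => (h i).1⟩, fun h i => ⟨h.2 i, h.1 i⟩⟩
  have hDD : ∀ e ∈ Finset.range (finrank K E + 1), D T e - D T' e = 0 := by
    refine eq_zero_of_forall_sum_mul_pow_eq_zero _ (fun e => D T e - D T' e)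
      (fun e => (Nat.card K : F) ^ e) (cast_card_pow_injective K F).injOn fun m _ => ?_
    simp only [sub_mul, Finset.sum_sub_distrib]
    have h1 := hf T (fun e => ((Nat.card K : F) ^ e) ^ m)
    have h2 := hf T' (fun e => ((Nat.card K : F) ^ e) ^ m)
    rw [hpow m _ hT] at h1
    rw [hpow m _ hT'] at h2
    rw [← h1, ← h2, sub_eq_zero]
    exact sum_tuple_mem_finrank_span l m (hT.trans hT'.symm)
  rw [hf, hf]
  refine Finset.sum_congr rfl fun e he => ?_
  rw [sub_eq_zero.1 (hDD e he)]

/-- The number of `U` above both `C` and `T` depends only on `dim(C + T) = k + t - dim(C ∩ T)`. -/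
theorem sum_above_sum_below_eq (hw : ∀ C, w C ≠ 0 → finrank K C = k) (htk : t ≤ k)
    (h : ∃ l, ∀ T : Submodule K E, finrank K T = t → ∑ C with T ≤ C, w C = l) (m : ℕ)
    {T T' : Submodule K E} (hT : finrank K T = t) (hT' : finrank K T' = t) :
    ∑ U with T ≤ U ∧ finrank K U = m, ∑ C with C ≤ U, w C =
      ∑ U with T' ≤ U ∧ finrank K U = m, ∑ C with C ≤ U, w C := by
  obtain ⟨c, hc⟩ := exists_card_above (K := K) (E := E) m
  have key : ∀ S : Submodule K E, finrank K S = t →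
      ∑ U with S ≤ U ∧ finrank K U = m, ∑ C with C ≤ U, w C =
      ∑ C, w C * (fun e => (c (t + k - e) : F)) (finrank K (C ⊓ S : Submodule K E)) := by
    intro S hS
    simp only [Finset.sum_filter (p := fun C => C ≤ _)]
    rw [Finset.sum_comm]
    refine Finset.sum_congr rfl fun C _ => ?_
    rw [← Finset.sum_filter, Finset.filter_filter, Finset.sum_const, nsmul_eq_mul, mul_comm]
    rcases eq_or_ne (w C) 0 with h0 | h0
    · rw [h0, zero_mul, zero_mul]
    have h1 := Submodule.finrank_sup_add_finrank_inf_eq C S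
    rw [hw C h0, hS] at h1
    rw [show t + k - finrank K (C ⊓ S : Submodule K E) = finrank K (C ⊔ S : Submodule K E) by omega,
      ← hc]
    congr 3
    ext U
    simp only [Finset.mem_filter, Finset.mem_univ, true_and, sup_le_iff]
    tauto
  rw [key T hT, key T' hT']
  exact sum_mul_finrank_inf_eq hw htk h (fun e => (c (t + k - e) : F)) hT hT'

end

/-! ### Circuits, hyperplanes, duality and nullity -/

section
open scoped Classical
open QPolymatroid

section
variable {K : Type u} {E : Type v} [Field K] [AddCommGroup E] [Module K E]
  (δ : SubspaceDuality K E) (N : QMatroid K E)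

theorem SubspaceDuality.perp_top : δ.perp ⊤ = ⊥ := by
  rw [← δ.perp_bot, δ.perp_perp]

theorem rk_le_finrank (A : Submodule K E) : N.rk A ≤ finrank K A := by
  simpa using N.rk_le A

theorem isFlat_iff (H : Submodule K E) :
    N.IsFlat H ↔ ∀ X, H ≤ X → N.rk H = N.rk X → X = H := by
  constructor
  · intro h X hHX hr
    refine le_antisymm ?_ hHX
    have : X ≤ N.closure H := le_sSup ⟨hHX, hr⟩
    rwa [h] at this
  · intro h
    refine le_antisymm (sSup_le fun X hX => (h X hX.1 hX.2).le) (le_sSup ⟨le_rfl, rfl⟩)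

theorem QPolymatroid.eq_of_rk_eq {r : ℕ} {M N : QPolymatroid K E r} (h : M.rk = N.rk) : M = N := by
  cases M
  cases N
  cases h
  rfl

theorem not_indep_iff (A : Submodule K E) : ¬ N.Indep A ↔ N.rk A < finrank K A := by
  have := rk_le_finrank N A
  unfold Indep
  omega

theorem isCircuit_ne_bot {C : Submodule K E} (h : N.IsCircuit C) : C ≠ ⊥ := by
  rintro rfl
  have := (not_indep_iff N ⊥).1 h.1
  simp at this

variable [FiniteDimensional K E]

theorem indep_of_le {A B : Submodule K E} (h : A ≤ B) (hB : N.Indep B) : N.Indep A := by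
  have h1 := N.rk_add_le h
  have h2 := rk_le_finrank N A
  unfold Indep at *
  omega

theorem exists_isCircuit_le {U : Submodule K E} (h : ¬ N.Indep U) :
    ∃ C, N.IsCircuit C ∧ C ≤ U := by
  obtain ⟨C, hC, hm⟩ := exists_minimal_le_of_wellFoundedLT (fun X => ¬ N.Indep X) U h
  exact ⟨C, hm, hC⟩

theorem finrank_eq_rk_add_one {U C : Submodule K E} (hC : N.IsCircuit C) (hCU : C ≤ U)
    (huniq : ∀ C', N.IsCircuit C' → C' ≤ U → C' = C) : finrank K U = N.rk U + 1 := by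
  have hU := (not_indep_iff N U).1 fun hU => hC.1 (indep_of_le N hCU hU)
  by_contra hne
  obtain ⟨x, hxC, hx0⟩ := (Submodule.ne_bot_iff C).1 (isCircuit_ne_bot N hC)
  obtain ⟨W, hW⟩ := exists_isCompl (K ∙ x)
  have hxU : K ∙ x ≤ U := (Submodule.span_singleton_le_iff_mem _ _).2 (hCU hxC)
  have hsup : K ∙ x ⊔ (W ⊓ U) = U := by
    rw [← sup_inf_assoc_of_le W hxU, hW.sup_eq_top, top_inf_eq]
  have hinf : K ∙ x ⊓ (W ⊓ U) = ⊥ := by rw [← inf_assoc, hW.inf_eq_bot, bot_inf_eq]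
  have h1 := Submodule.finrank_sup_add_finrank_inf_eq (K ∙ x) (W ⊓ U)
  rw [hsup, hinf, finrank_bot, finrank_span_singleton hx0] at h1
  have h2 := N.rk_mono (W ⊓ U) U inf_le_right
  -- With nullity at least 2, a hyperplane of `U` missing `x ∈ C` is still dependent, so it contains
  -- a circuit, which cannot be `C`.
  obtain ⟨C', hC', hle⟩ := exists_isCircuit_le N (U := W ⊓ U) ((not_indep_iff N _).2 (by omega))
  obtain rfl := huniq C' hC' (hle.trans inf_le_right)
  have h3 : x ∈ K ∙ x ⊓ (W ⊓ U) := ⟨Submodule.mem_span_singleton_self x, hle hxC⟩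
  rw [hinf] at h3
  exact hx0 ((Submodule.mem_bot K).1 h3)

/-- Maximal non-spanning subspaces are closed, and every proper flat lies in one. -/
theorem isHyperplane_iff (H : Submodule K E) :
    N.IsHyperplane H ↔ Maximal (fun X => N.rk X ≠ N.rk ⊤) H := by
  constructor
  · rintro ⟨hlt, hflat, hmax⟩
    rw [isFlat_iff] at hflat
    refine ⟨fun he => hlt.ne (hflat ⊤ le_top he).symm, fun X hX hHX => ?_⟩
    obtain ⟨Y, hXY, hY⟩ := exists_maximal_ge_of_wellFoundedGT (fun X => N.rk X ≠ N.rk ⊤) X hX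
    have hYflat : N.IsFlat Y := by
      rw [isFlat_iff]
      intro Z hYZ hr
      have hZ : N.rk Z ≠ N.rk ⊤ := hr ▸ hY.1
      exact le_antisymm (hY.2 hZ hYZ) hYZ
    rcases hmax Y hYflat (hHX.trans hXY) with rfl | rfl
    · exact absurd rfl hY.1
    · exact hXY
  · rintro ⟨hH, hmax⟩
    refine ⟨lt_top_iff_ne_top.2 fun he => hH (by rw [he]), ?_, ?_⟩
    · rw [isFlat_iff]
      intro X hHX hr
      have hX : N.rk X ≠ N.rk ⊤ := hr ▸ hH
      exact le_antisymm (hmax hX hHX) hHX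
    · intro Y hY hHY
      rw [isFlat_iff] at hY
      by_cases h : N.rk Y = N.rk ⊤
      · exact Or.inl (hY ⊤ le_top h).symm
      · exact Or.inr (le_antisymm (hmax h hHY) hHY)

theorem dual_indep_iff (A : Submodule K E) :
    (N.dual δ).Indep A ↔ N.rk (δ.perp A) = N.rk ⊤ := by
  have h1 := N.rk_top_le_dual δ A
  have h2 := N.rk_mono (δ.perp A) ⊤ le_top
  change 1 * finrank K A + N.rk (δ.perp A) - N.rk ⊤ = 1 * finrank K A ↔ _
  omega

theorem isHyperplane_iff_isCircuit_dual (H : Submodule K E) :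
    N.IsHyperplane H ↔ (N.dual δ).IsCircuit (δ.perp H) := by
  rw [isHyperplane_iff, IsCircuit]
  simp only [dual_indep_iff]
  constructor
  · rintro ⟨h1, h2⟩
    refine ⟨by simpa only [δ.perp_perp] using h1, fun X hX hle => ?_⟩
    rw [δ.perp_le_iff]
    exact h2 hX ((δ.le_perp_iff _ _).1 hle)
  · rintro ⟨h1, h2⟩
    refine ⟨by simpa only [δ.perp_perp] using h1, fun X hX hle => ?_⟩
    have := h2 (y := δ.perp X) (by simpa only [δ.perp_perp] using hX) (δ.perp_anti _ _ hle)
    rwa [δ.perp_le_iff, δ.perp_perp] at this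

theorem dual_dual : (N.dual δ).dual δ = N := by
  refine QPolymatroid.eq_of_rk_eq (funext fun A => ?_)
  have h1 := δ.finrank_perp A
  have h2 := N.rk_top_le_dual δ (δ.perp A)
  have h3 := N.rk_top_le_dual δ ⊤
  have h4 : N.rk ⊥ = 0 := by simpa using N.rk_le ⊥
  rw [δ.perp_perp] at h2
  rw [δ.perp_top, finrank_top, h4] at h3
  change 1 * finrank K A + (1 * finrank K (δ.perp A) + N.rk (δ.perp (δ.perp A)) - N.rk ⊤) -
    (1 * finrank K (⊤ : Submodule K E) + N.rk (δ.perp ⊤) - N.rk ⊤) = N.rk A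
  rw [δ.perp_perp, δ.perp_top, finrank_top, h4]
  omega

theorem dual_ell (U : Submodule K E) :
    (N.dual δ).ell U = finrank K (δ.perp U) - N.rk (δ.perp U) := by
  have h1 := δ.finrank_perp U
  have h2 := N.rk_top_le_dual δ U
  have h3 := N.rk_top_le_dual δ ⊤
  have h4 : N.rk ⊥ = 0 := by simpa using N.rk_le ⊥
  have h5 := rk_le_finrank N (δ.perp U)
  rw [δ.perp_top, finrank_top, h4] at h3
  change 1 * finrank K (⊤ : Submodule K E) + N.rk (δ.perp ⊤) - N.rk ⊤ -
    (1 * finrank K U + N.rk (δ.perp U) - N.rk ⊤) = _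
  rw [δ.perp_top, finrank_top, h4]
  omega

theorem rk_eq_finrank_of_lt_d {A : Submodule K E} (hA : finrank K A < N.d δ) :
    (N.dual δ).rk A = finrank K A := by
  by_contra hne
  have hdep : ¬ (N.dual δ).Indep A := fun h => hne (by simpa [Indep] using h)
  obtain ⟨C, hC, hCA⟩ := exists_isCircuit_le _ hdep
  have h1 : N.d δ ≤ finrank K C := Nat.sInf_le ⟨C, hC, rfl⟩
  have h2 := Submodule.finrank_mono hCA
  omega

end

variable {K : Type u} {E : Type v} [Field K] [Finite K] [AddCommGroup E] [Module K E]
  [FiniteDimensional K E] {F : Type w} [Field F]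

theorem pow_nullity_eq (N : QMatroid K E) (θ : F) {U : Submodule K E}
    (huniq : ∀ C C', N.IsCircuit C → N.IsCircuit C' → C ≤ U → C' ≤ U → C = C') :
    θ ^ (finrank K U - N.rk U) =
      1 + (θ - 1) * ∑ C with C ≤ U, if N.IsCircuit C then 1 else 0 := by
  by_cases hU : N.Indep U
  · have h1 : N.rk U = finrank K U := by simpa [Indep] using hU
    rw [Finset.sum_eq_zero fun C hC => if_neg fun hc => hc.1 (indep_of_le N (by simpa using hC) hU),
      h1]
    simp
  · obtain ⟨C, hC, hCU⟩ := exists_isCircuit_le N hU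
    have h1 := finrank_eq_rk_add_one N hC hCU fun C' hC' hle => huniq C' C hC' hC hle hCU
    rw [Finset.sum_eq_single_of_mem C (by simpa using hCU) fun C' hC' hne => if_neg fun hc =>
      hne (huniq C' C hc hC (by simpa using hC') hCU), if_pos hC, h1]
    simp

theorem sum_perp {A : Type*} [AddCommMonoid A] (δ : SubspaceDuality K E)
    (f : Submodule K E → A) : ∑ X, f (δ.perp X) = ∑ X, f X :=
  Equiv.sum_comp (⟨δ.perp, δ.perp, δ.perp_perp, δ.perp_perp⟩ : Submodule K E ≃ Submodule K E) f

/-- The up-sum of the left side at `V` is `θ` to the nullity of `V^⊥` in `M`, that is `1 + (θ - 1)`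
times the number of circuits in `V^⊥`. The constant 1 is carried by `Y = ⊤` alone. -/
theorem contractEval_dual_eq (δ : SubspaceDuality K E) (M : QMatroid K E) (θ : F)
    {Y : Submodule K E} (hY : Y ≠ ⊤)
    (huniq : ∀ C C', M.IsCircuit C → M.IsCircuit C' → C ≤ δ.perp Y → C' ≤ δ.perp Y → C = C') :
    contractEval (M.dual δ) θ Y = (θ - 1) * if M.IsCircuit (δ.perp Y) then 1 else 0 := by
  have key := eq_of_forall_sum_ge_eq (f := contractEval (M.dual δ) θ)
    (g := fun Y => (if Y = ⊤ then 1 else 0) +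
      (θ - 1) * if M.IsCircuit (δ.perp Y) then 1 else 0) Y fun V hV => by
    rw [sum_contractEval, dual_ell, pow_nullity_eq M θ fun C C' hC hC' h h' =>
      huniq C C' hC hC' (h.trans (δ.perp_anti _ _ hV)) (h'.trans (δ.perp_anti _ _ hV)),
      Finset.sum_add_distrib, ← Finset.mul_sum]
    congr 1
    · simp
    · rw [Finset.sum_filter, Finset.sum_filter, ← sum_perp δ]
      simp only [δ.le_perp_iff _ V, δ.perp_perp]
  rw [key, if_neg hY, zero_add]

end

/-! ### From constant sums to designs -/

section
open scoped Classical
open QPolymatroid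

variable {K : Type u} {E : Type v} [Field K] [Finite K] [AddCommGroup E] [Module K E]
  [FiniteDimensional K E] {F : Type w} [Field F]

theorem exists_eq_of_forall_finrank_eq {f : Submodule K E → F} {t : ℕ}
    (h : ∀ T T' : Submodule K E, finrank K T = t → finrank K T' = t → f T = f T') :
    ∃ l, ∀ T : Submodule K E, finrank K T = t → f T = l := by
  by_cases hT : ∃ T : Submodule K E, finrank K T = t
  · obtain ⟨T, hT⟩ := hT
    exact ⟨f T, fun T' hT' => h T' T hT' hT⟩
  · exact ⟨0, fun T hT' => absurd ⟨T, hT'⟩ hT⟩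

theorem isSubspaceDesign_of_sum_eq [CharZero F] {P : Submodule K E → Prop} {t k : ℕ}
    (h : ∃ l : F, ∀ T : Submodule K E, finrank K T = t →
      ∑ C with T ≤ C, (if P C ∧ finrank K C = k then 1 else 0) = l) :
    IsSubspaceDesign t k {C | P C ∧ finrank K C = k} := by
  refine ⟨fun X hX => hX.2, ?_⟩
  obtain ⟨l, hl⟩ := h
  have key : ∀ T : Submodule K E, finrank K T = t →
      (({X | X ∈ {C | P C ∧ finrank K C = k} ∧ T ≤ X}.ncard : ℕ) : F) = l := by
    intro T hT
    rw [← hl T hT, Finset.sum_boole, Finset.filter_filter, Set.ncard_eq_toFinset_card']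
    congr 2
    ext X
    simp [and_comm]
  by_cases hT : ∃ T : Submodule K E, finrank K T = t
  · obtain ⟨T, hT⟩ := hT
    exact ⟨_, fun T' hT' => Nat.cast_injective (R := F) ((key T' hT').trans (key T hT).symm)⟩
  · exact ⟨0, fun T hT' => absurd ⟨T, hT'⟩ hT⟩

theorem sum_isCircuit_above_eq [CharZero F] {N : QMatroid K E} {θ : F} (hθ : θ ≠ 1) {d t p : ℕ}
    (htd : t < d) (hd : ∀ C, N.IsCircuit C → d ≤ finrank K C)
    (hG : ∀ (m : ℕ) (T T' : Submodule K E), finrank K T = t → finrank K T' = t →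
      ∑ U with T ≤ U ∧ finrank K U = m, θ ^ (finrank K U - N.rk U) =
        ∑ U with T' ≤ U ∧ finrank K U = m, θ ^ (finrank K U - N.rk U))
    (hp : ∀ X : Submodule K E, finrank K X ≤ p →
      ∀ C C', N.IsCircuit C → N.IsCircuit C' → C ≤ X → C' ≤ X → C = C')
    {i : ℕ} (hi : i ≤ p) :
    ∃ l : F, ∀ T : Submodule K E, finrank K T = t →
      ∑ C with T ≤ C, (if N.IsCircuit C ∧ finrank K C = i then 1 else 0) = l := by
  induction i using Nat.strong_induction_on with
  | _ i ih =>
    set w : ℕ → Submodule K E → F := fun k C => if N.IsCircuit C ∧ finrank K C = k then 1 else 0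
      with hw
    have hsupp : ∀ k C, w k C ≠ 0 → finrank K C = k := fun k C h => by
      by_contra hne
      exact h (if_neg fun h => hne h.2)
    refine exists_eq_of_forall_finrank_eq fun T T' hT hT' => ?_
    obtain ⟨c, hc⟩ := exists_card_above (K := K) (E := E) i
    have h1 : ∀ S : Submodule K E, finrank K S = t →
        ∑ U with S ≤ U ∧ finrank K U = i, θ ^ (finrank K U - N.rk U) =
        c t + (θ - 1) * (∑ k ∈ Finset.range i,
          ∑ U with S ≤ U ∧ finrank K U = i, ∑ C with C ≤ U, w k C + ∑ C with S ≤ C, w i C) := by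
      intro S hS
      have h2 : ∀ U : Submodule K E, finrank K U = i →
          (∑ C with C ≤ U, if N.IsCircuit C then (1 : F) else 0) =
          ∑ k ∈ Finset.range i, ∑ C with C ≤ U, w k C + w i U := by
        intro U hU
        have h3 : w i U = ∑ C with C ≤ U, w i C := by
          rw [Finset.sum_eq_single_of_mem U (by simp)]
          intro C hC hne
          refine by_contra fun h => hne ?_
          exact Submodule.eq_of_le_of_finrank_eq (by simpa using hC) ((hsupp i C h).trans hU.symm)
        rw [h3, ← Finset.sum_range_succ (fun k => ∑ C with C ≤ U, w k C), Finset.sum_comm]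
        refine Finset.sum_congr rfl fun C hC => ?_
        have h4 := Submodule.finrank_mono (Finset.mem_filter.1 hC).2
        simp only [hw]
        by_cases hcirc : N.IsCircuit C
        · simp [hcirc]
          omega
        · simp [hcirc]
      rw [Finset.sum_congr rfl fun U hU => by
        have hU' := (Finset.mem_filter.1 hU).2.2
        rw [pow_nullity_eq N θ (hp U (hU'.trans_le hi)), h2 U hU'],
        Finset.sum_add_distrib, ← Finset.mul_sum, Finset.sum_add_distrib, Finset.sum_const, hc,
        nsmul_one, hS, Finset.sum_comm]
      congr 3
      rw [← Finset.filter_filter, Finset.sum_filter]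
      refine Finset.sum_congr rfl fun U _ => ?_
      by_cases hU : finrank K U = i
      · rw [if_pos hU]
      · rw [if_neg hU]
        exact (by_contra fun h => hU (hsupp i U fun h0 => h h0.symm))
    have h5 := hG i T T' hT hT'
    rw [h1 T hT, h1 T' hT', add_right_inj, mul_right_inj' (sub_ne_zero.2 hθ)] at h5
    have h6 : ∀ k ∈ Finset.range i,
        ∑ U with T ≤ U ∧ finrank K U = i, ∑ C with C ≤ U, w k C =
        ∑ U with T' ≤ U ∧ finrank K U = i, ∑ C with C ≤ U, w k C := by
      intro k hk
      rw [Finset.mem_range] at hk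
      -- Below `d` there are no circuits; from `d` on, `t < k`, as the design lemmas require.
      rcases lt_or_ge k d with hkd | hkd
      · have : ∀ C, w k C = 0 := fun C => if_neg fun h => by
          have := hd C h.1
          omega
        simp [this]
      · exact sum_above_sum_below_eq (hsupp k) (htd.le.trans hkd) (ih k hk (by omega)) i hT hT'
    rw [Finset.sum_congr rfl h6, add_right_inj] at h5
    exact h5

/-- Under `⊥`, members through `T` become blocks inside `T^⊥`, which has codimension `t`. -/
theorem exists_sum_above_perp [CharZero F] (δ : SubspaceDuality K E) {P Q : Submodule K E → Prop}
    (hPQ : ∀ X, Q X ↔ P (δ.perp X)) {t k j : ℕ} (hkj : k + j = finrank K E) (htk : t ≤ k)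
    (h : ∃ l : F, ∀ T : Submodule K E, finrank K T = t →
      ∑ C with T ≤ C, (if P C ∧ finrank K C = k then 1 else 0) = l) :
    ∃ l : F, ∀ T : Submodule K E, finrank K T = t →
      ∑ C with T ≤ C, (if Q C ∧ finrank K C = j then 1 else 0) = l := by
  obtain ⟨l, hl⟩ := exists_sum_below_eq (k := k) (fun C hC => by
    by_contra hne
    exact hC (if_neg fun h => hne h.2)) htk h
  refine ⟨l, fun T hT => ?_⟩
  have h1 := δ.finrank_perp T
  rw [← hl (δ.perp T) (by omega), Finset.sum_filter, Finset.sum_filter, ← sum_perp δ]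
  refine Finset.sum_congr rfl fun C _ => ?_
  have h2 := δ.finrank_perp C
  refine if_congr (δ.le_perp_iff _ _) (if_congr ?_ rfl rfl) rfl
  rw [hPQ, δ.perp_perp]
  exact and_congr_right fun _ => by omega

end

/-! ### The two families of designs -/

theorem corollary5p11 {K : Type u} {E : Type v} [Field K] [Finite K] [AddCommGroup E] [Module K E]
    [FiniteDimensional K E] (δ : SubspaceDuality K E) (M : QMatroid K E)
    (hcirc : ∃ C, M.IsCircuit C) (hcocirc : ∃ C, M.IsCocircuit δ C)
    {F : Type w} [Field F] [CharZero F] (θ : F) (hθ : θ ≠ 1)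
    (t : ℕ) (ht : 0 < t) (htd : t < M.d δ)
    (hR : (M.R δ t θ).ncard ≤ M.d δ - t)
    (hA : ∀ T : Submodule K E, finrank K T = t → ∀ j ≤ finrank K E - t,
      Polynomial.aeval θ ((M.dual δ).weightEnum j) = 0 →
        Polynomial.aeval θ (((M.dual δ).contract T).weightEnum j) = 0) :
    (∀ p : ℕ, IsUniquenessBound (M.IsCocircuit δ) p → ∀ i : ℕ, M.d δ ≤ i → i ≤ p →
      IsSubspaceDesign t (min i (finrank K E - t))
          {C | M.IsCocircuit δ C ∧ finrank K C = min i (finrank K E - t)} ∧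
        IsSubspaceDesign t (finrank K E - i)
          {H | M.IsHyperplane H ∧ finrank K H = finrank K E - i}) ∧
    (∀ p : ℕ, IsUniquenessBound M.IsCircuit p → ∀ i : ℕ, (M.dual δ).d δ ≤ i → i ≤ p →
      IsSubspaceDesign t (min i (finrank K E - t))
          {C | M.IsCircuit C ∧ finrank K C = min i (finrank K E - t)} ∧
        IsSubspaceDesign t (finrank K E - i)
          {H | (M.dual δ).IsHyperplane H ∧ finrank K H = finrank K E - i}) := by
  classical
  obtain ⟨C₀, hC₀⟩ := hcocirc
  have htn : t < finrank K E :=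
    htd.trans_le ((Nat.sInf_le ⟨C₀, hC₀, rfl⟩ : M.d δ ≤ _).trans (Submodule.finrank_le C₀))
  set J : Finset ℕ := (Finset.Icc 1 (finrank K E - t)).filter fun j =>
    Polynomial.aeval θ ((M.dual δ).weightEnum j) ≠ 0 with hJdef
  have hJR : M.R δ t θ = J := by
    ext j
    simp [QPolymatroid.R, hJdef, and_assoc]
  have hJ : J.card ≤ M.d δ - t := by rwa [hJR, Set.ncard_coe_finset] at hR
  have hJn : J ⊆ Finset.range (finrank K E + 1) := by
    intro j hj
    have := (Finset.mem_Icc.1 (Finset.mem_filter.1 hj).1).2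
    rw [Finset.mem_range]
    omega
  have h0 : ∀ T : Submodule K E, finrank K T = t → ∀ j, j ≠ 0 → j ∉ J →
      weightAbove (M.dual δ) θ T j = 0 := by
    intro T hT j hj0 hj
    by_cases hjn : j ≤ finrank K E - t
    · rw [weightAbove, ← aeval_weightEnum_contract]
      refine hA T hT j hjn (by_contra fun h => hj ?_)
      exact Finset.mem_filter.2 ⟨Finset.mem_Icc.2 ⟨Nat.one_le_iff_ne_zero.2 hj0, hjn⟩, h⟩
    · exact weightAbove_eq_zero _ _ (by omega)
  have hd : ∀ A : Submodule K E, finrank K A < M.d δ → (M.dual δ).rk A = finrank K A :=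
    fun A => rk_eq_finrank_of_lt_d δ M
  constructor
  · intro p hp i hdi hip
    have hcir : ∀ k ≤ p, ∃ l : F, ∀ T : Submodule K E, finrank K T = t →
        ∑ C with T ≤ C, (if (M.dual δ).IsCircuit C ∧ finrank K C = k then 1 else 0) = l :=
      fun k hk => sum_isCircuit_above_eq hθ htd (fun C hC => Nat.sInf_le ⟨C, hC, rfl⟩)
        (fun m T T' hT hT' => sum_above_pow_nullity_eq hd htd hJ hJn h0 hT hT' m) hp.1.2 hk
    refine ⟨isSubspaceDesign_of_sum_eq (hcir _ (min_le_left _ _ |>.trans hip)),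
      isSubspaceDesign_of_sum_eq (exists_sum_above_perp δ
        (fun H => isHyperplane_iff_isCircuit_dual δ M H) ?_ (htd.le.trans hdi) (hcir i hip))⟩
    have := hp.1.1
    omega
  · intro p hp i hdi hip
    have hiff : ∀ H, (M.dual δ).IsHyperplane H ↔ M.IsCircuit (δ.perp H) := fun H => by
      rw [isHyperplane_iff_isCircuit_dual δ, dual_dual]
    have hyp : ∀ k ≤ p, ∃ l : F, ∀ T : Submodule K E, finrank K T = t →
        ∑ H with T ≤ H, (if (M.dual δ).IsHyperplane H ∧ finrank K H = finrank K E - k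
          then 1 else 0) = l := by
      intro k hk
      have hkn := hk.trans hp.1.1
      -- Codimension 0 is separate: `⊤` is no hyperplane, yet its contraction has value 1.
      rcases Nat.eq_zero_or_pos k with rfl | hk0
      · refine ⟨0, fun T _ => Finset.sum_eq_zero fun H _ => if_neg ?_⟩
        rintro ⟨hH, hHn⟩
        exact hH.1.ne (Submodule.eq_top_of_finrank_eq hHn)
      refine exists_eq_of_forall_finrank_eq fun T T' hT hT' => ?_
      have key : ∀ S : Submodule K E, weightAbove (M.dual δ) θ S k = (θ - 1) *
          ∑ H with S ≤ H, (if (M.dual δ).IsHyperplane H ∧ finrank K H = finrank K E - k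
            then 1 else 0) := by
        intro S
        rw [weightAbove, ← Finset.filter_filter, Finset.sum_filter, Finset.mul_sum]
        refine Finset.sum_congr rfl fun H _ => ?_
        have h1 := δ.finrank_perp H
        by_cases hH : finrank K H + k = finrank K E
        · have hH' : finrank K H = finrank K E - k := by omega
          rw [if_pos hH, contractEval_dual_eq δ M θ (fun he => by
            rw [he, finrank_top] at hH
            omega) (hp.1.2 _ (by omega))]
          simp only [hiff, hH', and_true]
        · rw [if_neg hH, if_neg (fun h => hH (by omega)), mul_zero]
      have h2 := weightAbove_eq_of_card_le hd hJ hJn h0 hT hT' k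
      rw [key T, key T'] at h2
      exact mul_left_cancel₀ (sub_ne_zero.2 hθ) h2
    -- Dualising needs `t` to be at most the hyperplane dimension `n - min i (n - t)`; the
    -- truncation ensures it.
    refine ⟨isSubspaceDesign_of_sum_eq (exists_sum_above_perp δ (fun C => ?_) ?_ ?_
      (hyp (min i (finrank K E - t)) (min_le_left _ _ |>.trans hip))),
      isSubspaceDesign_of_sum_eq (hyp i hip)⟩
    · rw [hiff, δ.perp_perp]
    · omega
    · omega
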